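/- Let $K$ be a real closed field. A cut of an ordered field $F$ is a pair $C=(C^-,C^+)$ such that $F$ is the disjoint union of $C^-$ and $C^+$ (one of which may be empty) and $C^-<C^+$; it is realized by an element $a$ of an ordered extension of $F$ if $C^-<a<C^+$. For $F$ real closed, a set $\mathcal C$ of cuts of $F$ is called independent if for every subset $\mathcal C_0\subseteq\mathcal C$, every real closed field $L$ extending $F$, and every choice of realizations $a_C\in L$ of the cuts $C\in\mathcal C_0$, no cut in $\mathcal C\setminus\mathcal C_0$ is realized in the real closure of $F(a_C : C\in\mathcal C_0)$ inside $L$. The height $h(K)$ of $K$ is the least ordinal $\alpha$ for which there is an increasing sequence $(K_i)_{i\le\alpha}$ of real closed fields, continuous in the sense that $K_\delta=\bigcup_{i<\delta}K_i$ for limit $\delta\le\alpha$, such that $K_0$ is countable, $K_\alpha=K$, and for each $i<\alpha$ the field $K_{i+1}$ is generated over $K_i$, as a real closed field, by realizations, one for each cut, of an independent set of cuts of $K_i$. Then such an ordinal exists, so that $h(K)$ is well defined, and $$|h(K)|\le |K|\le 2^{\max(|h(K)|,\aleph_0)}.$$ In particular, $|h(K)|\le|K|\le 2^{|h(K)|}$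 whenever $h(K)$ is infinite. -/

import Mathlib

open Cardinal Ordinal

universe u v

/-- A cut in a linear order `K`: a pair `(C⁻, C⁺)` with `K` the disjoint union of `C⁻` and `C⁺`,
and `C⁻ < C⁺`. Either side may be empty. -/
@[ext]
structure FieldCut (K : Type u) [LinearOrder K] where
  lower : Set K
  upper : Set K
  disjoint : Disjoint lower upper
  union_eq : lower ∪ upper = Set.univ
  lt : ∀ x ∈ lower, ∀ y ∈ upper, x < y

/-- The element `a` of an ordered extension `L` of `K` realizes (fills) the cut `C` of `K`:
`C⁻ < a < C⁺`. -/
def FieldCut.RealizedBy {K : Type u} {L : Type v} [Field K] [LinearOrder K] [Field L]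
    [LinearOrder L] [Algebra K L] (C : FieldCut K) (a : L) : Prop :=
  (∀ x ∈ C.lower, algebraMap K L x < a) ∧ (∀ y ∈ C.upper, a < algebraMap K L y)

/-- The real closure, inside a real closed field `L`, of the subfield generated by `S`. For `L` real
closed this is the set of elements of `L` that are algebraic over that subfield. -/
def realClosureIn {L : Type u} [Field L] (S : Set L) : Set L :=
  {x | IsAlgebraic (Subfield.closure S) x}

/-- A set `𝒞` of cuts of `K` is independent: whenever `𝒞₀ ⊆ 𝒞` and each `C ∈ 𝒞₀` is realized by
`a C` in a real closed field `L` extending the ordered field `K`, the real closure of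
`K(a C : C ∈ 𝒞₀)` realizes no cut in `𝒞 \ 𝒞₀`. (Any ordered field `L` containing `K` may be replaced
by its real closure, so nothing is lost by taking `L` real closed.) -/
def CutsIndependent {K : Type u} [Field K] [LinearOrder K] (𝒞 : Set (FieldCut K)) : Prop :=
  ∀ (L : Type u) [Field L] [LinearOrder L] [IsStrictOrderedRing L] [IsRealClosed L] [Algebra K L],
    StrictMono (algebraMap K L) →
    ∀ 𝒞₀ ⊆ 𝒞, ∀ a : FieldCut K → L, (∀ C ∈ 𝒞₀, C.RealizedBy (a C)) →
    ∀ C ∈ 𝒞 \ 𝒞₀, ∀ b ∈ realClosureIn (Set.range (algebraMap K L) ∪ a '' 𝒞₀), ¬ C.RealizedBy b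

/-- `F'` is generated over `F`, as a real closed field (inside the real closed field `K`), by
realizations `a C`, one for each member `C` of an independent set `𝒞` of cuts of `F`. -/
def IsIndependentCutExtension {K : Type u} [Field K] [LinearOrder K] (F F' : Subfield K) : Prop :=
  ∃ (𝒞 : Set (FieldCut F)) (a : FieldCut F → K),
    CutsIndependent 𝒞 ∧ (∀ C ∈ 𝒞, C.RealizedBy (a C)) ∧
    (F' : Set K) = realClosureIn ((F : Set K) ∪ a '' 𝒞)

/-- `F i` (`i ≤ α`) is a continuous increasing sequence of real closed fields with `F 0` countable,
`F α = K`, and `F (i + 1)` generated over `F i`, as a real closed field, by realizations of an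
independent set of cuts. The values `F i` for `i > α` are irrelevant. -/
structure IsHeightChain {K : Type u} [Field K] [LinearOrder K]
    (α : Ordinal.{u}) (F : Ordinal.{u} → Subfield K) : Prop where
  realClosed : ∀ i ≤ α, IsRealClosed (F i)
  mono : ∀ i j, i ≤ j → j ≤ α → F i ≤ F j
  continuous : ∀ i ≤ α, Order.IsSuccLimit i → ∀ x ∈ F i, ∃ j < i, x ∈ F j
  countable_zero : (F 0 : Set K).Countable
  top : F α = ⊤
  step : ∀ i < α, IsIndependentCutExtension (F i) (F (i + 1))

/-- The ordinals that are lengths of chains as in the definition of the height of `K`. -/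
def heightChainLengths (K : Type u) [Field K] [LinearOrder K] : Set Ordinal.{u} :=
  {α | ∃ F : Ordinal.{u} → Subfield K, IsHeightChain α F}

/-- The height `h(K)`: the least length of such a chain. -/
noncomputable def height (K : Type u) [Field K] [LinearOrder K] : Ordinal.{u} :=
  sInf (heightChainLengths K)

/-! Adding the elements of `K` one at a time, each in at most one new cut, gives a chain of length
the initial ordinal of `#K`; this proves existence and the lower bound.

For the upper bound put κ = max(|h(K)|, ℵ₀) and prove by induction along a chain that each stage has
at most 2^κ elements and is `Thin κ`: every subset has a cofinal subset of size at most κ. Thinness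
controls cardinality, since a cut of a thin field is determined by a κ-sized cofinal part of its
lower half. At most (2^κ)^κ = 2^κ cuts are therefore available at each step (`CutIndep.mk_le`).

The crux is that an independent extension preserves thinness (`Thin.realClosureIn_union`). Adjoining
one element adds only countably many archimedean classes modulo torsion, and thinness can be read
off the classes, so finite subextensions stay thin. If the whole extension were not thin, a set S
whose small subsets are all strictly bounded in S would eventually stay in a single cut of each
finite subextension. A countable construction then finds two elements of S in the same cut of some
finite subextension G, not in G, and with disjoint supports over G. Independence forbids this
(`CutIndep.mem_of_sameCut`): by exchange, and because elements in the same cut generate real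
closures realizing the same cuts (`SameCut.exists_mem_realClosureIn`), some generator would have its
cut realized without it. -/

/-! ### Artin–Schreier theory: irreducible polynomials have degree at most two -/

open Polynomial in
theorem mem_range_of_natDegree_minpoly_le_two {F L : Type*} [Field F] [Field L] [CharZero F]
    [Algebra F L] (hsq : ∀ d : F, IsSquare (algebraMap F L d) → IsSquare d) {y : L}
    (hy : IsIntegral F y) (hdeg : (minpoly F y).natDegree ≤ 2) : y ∈ (algebraMap F L).range := by
  have hpos := minpoly.natDegree_pos hy
  rcases (show (minpoly F y).natDegree = 1 ∨ (minpoly F y).natDegree = 2 by omega) with h1 | h2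
  · exact minpoly.natDegree_eq_one_iff.1 h1
  · have hm := minpoly.monic hy
    have h0 := minpoly.aeval F y
    have hlead : (minpoly F y).coeff 2 = 1 := by rw [← h2]; exact hm
    rw [aeval_eq_sum_range, h2, Finset.sum_range_succ, Finset.sum_range_succ,
      Finset.sum_range_one, hlead] at h0
    set b := (minpoly F y).coeff 1
    set c := (minpoly F y).coeff 0
    simp only [Algebra.smul_def, pow_zero, pow_one, map_one, one_mul, mul_one] at h0
    have : CharZero L := charZero_of_injective_algebraMap (algebraMap F L).injective
    -- By the quadratic formula, `2y + b` is a square root of the discriminant in `L`.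
    obtain ⟨s, hs⟩ := hsq (b ^ 2 - 4 * c) ⟨2 * y + algebraMap F L b, by
      simp only [map_sub, map_mul, map_pow, map_ofNat]
      linear_combination (-4) * h0⟩
    have hs' := congrArg (algebraMap F L) hs
    simp only [map_sub, map_mul, map_pow, map_ofNat] at hs'
    have hprod : (2 * y + algebraMap F L b - algebraMap F L s) *
        (2 * y + algebraMap F L b + algebraMap F L s) = 0 := by
      linear_combination 4 * h0 + hs'
    rcases mul_eq_zero.1 hprod with h | h
    · refine ⟨(s - b) / 2, ?_⟩
      simp only [map_div₀, map_sub, map_ofNat]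
      field_simp
      linear_combination -h
    · refine ⟨(-s - b) / 2, ?_⟩
      simp only [map_div₀, map_sub, map_neg, map_ofNat]
      field_simp
      linear_combination -h

namespace IsRealClosed

open Polynomial IntermediateField

variable {R : Type u} [Field R] [LinearOrder R] [IsStrictOrderedRing R] [IsRealClosed R]

theorem finrank_eq_one_of_odd {E : Type*} [Field E] [Algebra R E] [FiniteDimensional R E]
    (h : Odd (Module.finrank R E)) : Module.finrank R E = 1 := by
  obtain ⟨α, hα⟩ := Field.exists_primitive_element R E
  have hint : IsIntegral R α := IsIntegral.of_finite R α
  have hdeg : (minpoly R α).natDegree = Module.finrank R E := by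
    rw [← IntermediateField.adjoin.finrank hint, hα, IntermediateField.finrank_top']
  obtain ⟨x, hx⟩ := exists_isRoot_of_odd_natDegree (f := minpoly R α) (by rwa [hdeg])
  rw [← hdeg]
  exact natDegree_eq_of_degree_eq_some (degree_eq_one_of_irreducible_of_root
    (minpoly.irreducible hint) hx)

/-- The usual formula: with r² = a² + b², a root of a + bi is √((r + a)/2) ± √((r − a)/2)·i, the
sign being that of b. -/
theorem isSquare_of_mem_adjoin_I {N : Type*} [Field N] [Algebra R N] {i : N} (hi : i ^ 2 = -1)
    (z : R⟮i⟯) : IsSquare z := by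
  have hint : IsIntegral R i := ⟨X ^ 2 + 1, by monicity!, by simp [hi]⟩
  obtain ⟨z, hz⟩ := z
  have hz' : z ∈ Algebra.adjoin R {i} := by
    rw [← IntermediateField.adjoin_simple_toSubalgebra_of_isAlgebraic hint.isAlgebraic]; exact hz
  have key : ∃ a b : R, z = algebraMap R N a + algebraMap R N b * i := by
    clear hz
    induction hz' using Algebra.adjoin_induction with
    | mem x hx => exact ⟨0, 1, by simpa using hx⟩
    | algebraMap r => exact ⟨r, 0, by simp⟩
    | add x y _ _ hx hy =>
      obtain ⟨a, b, rfl⟩ := hx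
      obtain ⟨c, d, rfl⟩ := hy
      exact ⟨a + c, b + d, by simp only [map_add]; ring⟩
    | mul x y _ _ hx hy =>
      obtain ⟨a, b, rfl⟩ := hx
      obtain ⟨c, d, rfl⟩ := hy
      exact ⟨a * c - b * d, a * d + b * c, by
        simp only [map_add, map_sub, map_mul]; linear_combination
          (algebraMap R N b * algebraMap R N d) * hi⟩
  obtain ⟨a, b, rfl⟩ := key
  have hsqrt : ∀ x : R, 0 ≤ x → ∃ y, 0 ≤ y ∧ y * y = x := fun x hx => by
    obtain ⟨y, hy⟩ := IsSquare.of_nonneg hx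
    exact ⟨|y|, abs_nonneg y, by rw [abs_mul_abs_self, hy]⟩
  obtain ⟨r, hr0, hr⟩ := hsqrt (a ^ 2 + b ^ 2) (by positivity)
  have har : |a| ≤ r := by
    refine abs_le_of_sq_le_sq ?_ hr0
    nlinarith [sq_nonneg b]
  obtain ⟨c, hc0, hc⟩ := hsqrt ((r + a) / 2) (by linarith [neg_abs_le a])
  obtain ⟨d, hd0, hd⟩ := hsqrt ((r - a) / 2) (by linarith [le_abs_self a])
  have hcd : 2 * c * d = |b| := by
    apply (sq_eq_sq₀ (by positivity) (abs_nonneg b)).1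
    rw [sq_abs]
    linear_combination 4 * d * d * hc + 2 * (r + a) * hd + hr
  have hex : ∃ d' : R, d' * d' = d * d ∧ 2 * c * d' = b := by
    rcases abs_choice b with h | h
    · exact ⟨d, rfl, by rw [hcd, h]⟩
    · exact ⟨-d, by ring, by linear_combination -hcd - h⟩
  obtain ⟨d', hd', hcd'⟩ := hex
  have himem : i ∈ R⟮i⟯ := mem_adjoin_simple_self R i
  refine ⟨⟨algebraMap R N c + algebraMap R N d' * i, ?_⟩, ?_⟩
  · exact add_mem (IntermediateField.algebraMap_mem _ _)
      (mul_mem (IntermediateField.algebraMap_mem _ _) himem)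
  · apply Subtype.ext
    change algebraMap R N a + algebraMap R N b * i =
      (algebraMap R N c + algebraMap R N d' * i) * (algebraMap R N c + algebraMap R N d' * i)
    have h1 : a = c * c - d' * d' := by rw [hd', hc, hd]; ring
    rw [← hcd', h1]
    simp only [map_sub, map_mul, map_ofNat]
    linear_combination (-(algebraMap R N d' * algebraMap R N d')) * hi

/-- Artin's argument: the fixed field of a Sylow 2-subgroup has odd degree, hence is `R`, so the
degree is a power of 2. If `N` were larger than `R(i)`, an index-two subgroup would give a quadratic
extension of `R(i)`, where every element is already a square. -/
theorem finrank_le_two {N : Type*} [Field N] [Algebra R N] [FiniteDimensional R N] [IsGalois R N]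
    {i : N} (hi : i ^ 2 = -1) : Module.finrank R N ≤ 2 := by
  have hcard : Nat.card Gal(N/R) = Module.finrank R N := IsGalois.card_aut_eq_finrank R N
  have : Fact (Nat.Prime 2) := ⟨Nat.prime_two⟩
  obtain ⟨P⟩ : Nonempty (Sylow 2 Gal(N/R)) := inferInstance
  have hmul : Module.finrank R (fixedField P.1) * Nat.card P.1 = Module.finrank R N := by
    rw [← IntermediateField.finrank_fixedField_eq_card, Module.finrank_mul_finrank]
  have hidx : P.1.index = Module.finrank R (fixedField P.1) := by
    have := P.1.card_mul_index
    rw [hcard, ← hmul, mul_comm] at this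
    exact Nat.eq_of_mul_eq_mul_right Nat.card_pos this
  have hone : Module.finrank R (fixedField P.1) = 1 := by
    apply finrank_eq_one_of_odd
    rw [← hidx, ← Nat.not_even_iff_odd, even_iff_two_dvd]
    exact P.not_dvd_index
  rw [hone, one_mul] at hmul
  obtain ⟨k, hk⟩ := P.2.exists_card_eq
  have hNk : Module.finrank R N = 2 ^ k := by rw [← hmul]; exact hk
  have htower : Module.finrank R R⟮i⟯ * Module.finrank R⟮i⟯ N = Module.finrank R N :=
    Module.finrank_mul_finrank _ _ _
  have hCN : Module.finrank R⟮i⟯ N = 1 := by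
    by_contra hne
    obtain ⟨m, -, hm⟩ := (Nat.dvd_prime_pow Nat.prime_two).1
      (show Module.finrank R⟮i⟯ N ∣ 2 ^ k by rw [← hNk, ← htower]; exact dvd_mul_left _ _)
    obtain ⟨m, rfl⟩ : ∃ l, m = l + 1 := Nat.exists_eq_succ_of_ne_zero (by
      rintro rfl; exact hne (by simpa using hm))
    have hcard' : Nat.card Gal(N/R⟮i⟯) = 2 ^ (m + 1) := by
      rw [IsGalois.card_aut_eq_finrank, hm]
    obtain ⟨H, hH⟩ := Sylow.exists_subgroup_card_pow_prime (G := Gal(N/R⟮i⟯)) 2 (n := m)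
      (by rw [hcard']; exact pow_dvd_pow _ (Nat.le_succ m))
    have h2 : Module.finrank R⟮i⟯ (fixedField H) = 2 := by
      have := Module.finrank_mul_finrank R⟮i⟯ (fixedField H) N
      rw [IntermediateField.finrank_fixedField_eq_card, hH, hm, pow_succ, mul_comm] at this
      exact Nat.eq_of_mul_eq_mul_left (by positivity) this
    have hbot : ∀ y : fixedField H, y ∈ (algebraMap R⟮i⟯ (fixedField H)).range := fun y =>
      mem_range_of_natDegree_minpoly_le_two (fun d _ => isSquare_of_mem_adjoin_I hi d)
        (IsIntegral.of_finite _ y) (h2 ▸ minpoly.natDegree_le y)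
    have h1 : Module.finrank R⟮i⟯ (fixedField H) = 1 := by
      have hle : Module.finrank R⟮i⟯ (fixedField H) ≤ Module.finrank R⟮i⟯ R⟮i⟯ :=
        LinearMap.finrank_le_finrank_of_surjective (f := Algebra.linearMap R⟮i⟯ (fixedField H))
          fun y => hbot y
      rw [Module.finrank_self] at hle
      omega
    omega
  have hint : IsIntegral R i := IsIntegral.of_finite R i
  rw [← htower, hCN, mul_one, IntermediateField.adjoin.finrank hint]
  have hdvd : minpoly R i ∣ X ^ 2 + 1 := minpoly.dvd R i (by simp [hi])
  have hmon : (X ^ 2 + 1 : R[X]).Monic := by monicity!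
  calc _ ≤ (X ^ 2 + 1 : R[X]).natDegree := natDegree_le_of_dvd hdvd hmon.ne_zero
    _ ≤ 2 := by compute_degree

/-- Irreducible polynomials over a real closed field have degree at most two. -/
theorem natDegree_le_two {p : R[X]} (hp : Irreducible p) : p.natDegree ≤ 2 := by
  -- The factor `X ^ 2 + 1` puts a square root of −1 into the splitting field.
  have hne : p * (X ^ 2 + 1) ≠ 0 :=
    mul_ne_zero hp.ne_zero (show (X ^ 2 + 1 : R[X]).Monic by monicity!).ne_zero
  let N := (p * (X ^ 2 + 1)).SplittingField
  have hsplit := SplittingField.splits (p * (X ^ 2 + 1))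
  have hne' : (p * (X ^ 2 + 1)).map (algebraMap R N) ≠ 0 := Polynomial.map_ne_zero hne
  have : IsGalois R N := ⟨⟩
  have root : ∀ q : R[X], q ∣ p * (X ^ 2 + 1) → q.degree ≠ 0 → ∃ z : N, aeval z q = 0 := by
    intro q hq hdeg
    have := hsplit.of_dvd hne' (Polynomial.map_dvd _ hq)
    obtain ⟨z, hz⟩ := this.exists_eval_eq_zero (by rwa [degree_map])
    exact ⟨z, by rwa [eval_map_algebraMap] at hz⟩
  obtain ⟨i, hi⟩ := root (X ^ 2 + 1) (dvd_mul_left _ _) (by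
    rw [show (X ^ 2 + 1 : R[X]).degree = 2 by compute_degree!]; decide)
  obtain ⟨z, hz⟩ := root p (dvd_mul_right _ _)
    (fun h => hp.not_isUnit (isUnit_iff_degree_eq_zero.2 h))
  have hi' : i ^ 2 = -1 := by
    simp only [map_add, map_pow, aeval_X, map_one] at hi
    linear_combination hi
  have hmin : p.natDegree = (minpoly R z).natDegree := by
    rw [← minpoly.eq_of_irreducible hp hz, natDegree_mul_C]
    simpa using hp.ne_zero
  rw [hmin]
  exact (minpoly.natDegree_le z).trans (finrank_le_two hi')

/-- A real closed field is algebraically closed in every ordered extension. -/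
theorem mem_range_of_isAlgebraic {L : Type*} [Field L] [LinearOrder L] [IsStrictOrderedRing L]
    [Algebra R L] (hmono : StrictMono (algebraMap R L)) {x : L} (hx : IsAlgebraic R x) :
    x ∈ (algebraMap R L).range := by
  refine mem_range_of_natDegree_minpoly_le_two (fun d hd => ?_) hx.isIntegral
    (natDegree_le_two (minpoly.irreducible hx.isIntegral))
  apply IsSquare.of_nonneg
  have := hd.nonneg
  rwa [← map_zero (algebraMap R L), hmono.le_iff_le] at this

end IsRealClosed

/-! ### Intermediate value theorem and Rolle's theorem for polynomials -/

namespace IsRealClosed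

open Polynomial

variable {R : Type u} [Field R] [LinearOrder R] [IsStrictOrderedRing R] [IsRealClosed R]

theorem eval_mul_eval_pos_of_irreducible {p : R[X]} (hp : Irreducible p) {a b : R} (hab : a ≤ b)
    (h : ∀ c, a ≤ c → c ≤ b → p.eval c ≠ 0) : 0 < p.eval a * p.eval b := by
  have h2 := natDegree_le_two hp
  have hev : ∀ x, p.eval x = p.coeff 0 + p.coeff 1 * x + p.coeff 2 * x ^ 2 := fun x => by
    rw [eval_eq_sum_range' (n := 3) (Nat.lt_succ_of_le h2)]
    simp [Finset.sum_range_succ]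
  by_cases hroot : ∃ r, p.IsRoot r
  · obtain ⟨r, hr⟩ := hroot
    have hd : p.natDegree = 1 :=
      natDegree_eq_of_degree_eq_some (degree_eq_one_of_irreducible_of_root hp hr)
    have hc2 : p.coeff 2 = 0 := coeff_eq_zero_of_natDegree_lt (by omega)
    have hr' : p.coeff 0 = -(p.coeff 1 * r) := by
      have : p.eval r = 0 := hr
      rw [hev, hc2] at this
      linear_combination this
    have hev' : ∀ x, p.eval x = p.coeff 1 * (x - r) := fun x => by rw [hev, hc2, hr']; ring
    have hA : p.coeff 1 ≠ 0 := by
      intro h0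
      exact h a le_rfl hab (by rw [hev', h0, zero_mul])
    have hA2 : 0 < p.coeff 1 * p.coeff 1 := mul_self_pos.2 hA
    have : 0 < (a - r) * (b - r) := by
      rcases lt_or_ge r a with h1 | h1
      · exact mul_pos (by linarith) (by linarith)
      · rcases lt_or_ge b r with h3 | h3
        · exact mul_pos_of_neg_of_neg (by linarith) (by linarith)
        · exact absurd hr (h r h1 h3)
    rw [hev', hev']
    calc 0 < p.coeff 1 * p.coeff 1 * ((a - r) * (b - r)) := mul_pos hA2 this
      _ = _ := by ring
  · push Not at hroot
    have h1 : p.natDegree ≠ 1 := fun h1 =>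
      have ⟨r, hr⟩ := exists_root_of_degree_eq_one
        (degree_eq_iff_natDegree_eq_of_pos one_pos |>.2 h1)
      hroot r hr
    have h0 : p.natDegree ≠ 0 := hp.natDegree_pos.ne'
    have hA : p.coeff 2 ≠ 0 := by
      rw [show 2 = p.natDegree by omega]
      exact leadingCoeff_ne_zero.2 hp.ne_zero
    have hD : p.coeff 1 ^ 2 - 4 * p.coeff 2 * p.coeff 0 < 0 := by
      by_contra hD
      obtain ⟨s, hs⟩ := IsSquare.of_nonneg (not_lt.1 hD)
      refine hroot ((s - p.coeff 1) / (2 * p.coeff 2)) ?_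
      rw [IsRoot.def, hev]
      field_simp
      linear_combination -hs
    have hpos : ∀ x, 0 < p.coeff 2 * p.eval x := fun x => by
      rw [hev]
      -- Completing the square: 4A·p(x) = (2Ax + B)² − (B² − 4AC), with negative discriminant.
      nlinarith [sq_nonneg (2 * p.coeff 2 * x + p.coeff 1)]
    have := mul_pos (hpos a) (hpos b)
    have hA2 : 0 < p.coeff 2 * p.coeff 2 := mul_self_pos.2 hA
    refine (mul_pos_iff_of_pos_left hA2).1 ?_
    calc 0 < _ := this
      _ = _ := by ring

/-- The claim is multiplicative in `p`, so factorization reduces it to irreducible factors, of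
degree at most two. -/
theorem eval_mul_eval_pos {p : R[X]} {a b : R} (hab : a ≤ b)
    (h : ∀ c, a ≤ c → c ≤ b → p.eval c ≠ 0) : 0 < p.eval a * p.eval b := by
  induction p using WfDvdMonoid.induction_on_irreducible with
  | zero => exact absurd (by simp) (h a le_rfl hab)
  | unit u hu =>
    obtain ⟨c, hc, rfl⟩ := Polynomial.isUnit_iff.1 hu
    simpa using hc.ne_zero
  | mul f i hf hi ih =>
    have h1 := eval_mul_eval_pos_of_irreducible hi hab fun c h1 h2 h3 => h c h1 h2 (by simp [h3])
    have h2 := ih fun c h1 h2 h3 => h c h1 h2 (by simp [h3])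
    rw [eval_mul, eval_mul]
    calc 0 < _ := mul_pos h1 h2
      _ = _ := by ring

/-- The intermediate value theorem for polynomials over a real closed field. -/
theorem exists_isRoot_of_eval_mul_eval_neg {p : R[X]} {a b : R} (hab : a ≤ b)
    (h : p.eval a * p.eval b < 0) : ∃ c, a < c ∧ c < b ∧ p.eval c = 0 := by
  by_contra! hc
  refine lt_asymm h (eval_mul_eval_pos hab fun c h1 h2 h3 => ?_)
  rcases h1.eq_or_lt with rfl | h1
  · simp [h3] at h
  rcases h2.eq_or_lt with rfl | h2
  · simp [h3] at h
  exact hc c h1 h2 h3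

/-- Write p = (X − a)^(m+1) (X − b)^(n+1) g with g of constant sign on [a, b]. Then p' = (X − a)^m
(X − b)^n φ, and φ has opposite signs at a and b. -/
theorem exists_derivative_eval_eq_zero_of_consecutive {p : R[X]} (hp : p ≠ 0) {a b : R}
    (hab : a < b) (ha : p.eval a = 0) (hb : p.eval b = 0)
    (h : ∀ c, a < c → c < b → p.eval c ≠ 0) :
    ∃ c, a < c ∧ c < b ∧ p.derivative.eval c = 0 := by
  obtain ⟨q, hq, hqa⟩ := exists_eq_pow_rootMultiplicity_mul_and_not_dvd p hp a
  have hm := (rootMultiplicity_pos hp).2 ha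
  generalize rootMultiplicity a p = m at hq hm
  have hq0 : q ≠ 0 := by rintro rfl; simp at hqa
  have hqb : q.eval b = 0 := by
    rw [hq, eval_mul, eval_pow, eval_sub, eval_X, eval_C] at hb
    exact (mul_eq_zero.1 hb).resolve_left (pow_ne_zero _ (sub_ne_zero.2 hab.ne'))
  obtain ⟨g, hg, hgb⟩ := exists_eq_pow_rootMultiplicity_mul_and_not_dvd q hq0 b
  have hn := (rootMultiplicity_pos hq0).2 hqb
  generalize rootMultiplicity b q = n at hg hn
  obtain ⟨m, rfl⟩ := Nat.exists_eq_succ_of_ne_zero hm.ne'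
  obtain ⟨n, rfl⟩ := Nat.exists_eq_succ_of_ne_zero hn.ne'
  rw [dvd_iff_isRoot, IsRoot.def] at hqa hgb
  have hga : g.eval a ≠ 0 := fun h0 => hqa (by rw [hg, eval_mul, h0, mul_zero])
  have hgpos : 0 < g.eval a * g.eval b := eval_mul_eval_pos hab.le fun c h1 h2 h3 => by
    rcases h1.eq_or_lt with rfl | h1
    · exact hga h3
    rcases h2.eq_or_lt with rfl | h2
    · exact hgb h3
    exact h c h1 h2 (by rw [hq, hg]; simp [h3])
  set φ : R[X] := C (m + 1 : R) * (X - C b) * g + C (n + 1 : R) * (X - C a) * g +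
    (X - C a) * (X - C b) * derivative g with hφ
  have hder : derivative p = (X - C a) ^ m * (X - C b) ^ n * φ := by
    rw [hq, hg, hφ]
    simp only [derivative_mul, derivative_X_sub_C_pow, Nat.succ_eq_add_one, Nat.add_sub_cancel,
      Nat.cast_add, Nat.cast_one, map_add, map_one, map_natCast]
    ring
  have hneg : φ.eval a * φ.eval b < 0 := by
    have e1 : φ.eval a = (m + 1) * (a - b) * g.eval a := by simp [hφ]
    have e2 : φ.eval b = (n + 1) * (b - a) * g.eval b := by simp [hφ]
    have : 0 < ((m : R) + 1) * (n + 1) * (b - a) ^ 2 * (g.eval a * g.eval b) := by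
      have := sub_pos.2 hab
      positivity
    rw [e1, e2]
    linear_combination this
  obtain ⟨c, h1, h2, h3⟩ := exists_isRoot_of_eval_mul_eval_neg hab.le hneg
  exact ⟨c, h1, h2, by rw [hder, eval_mul, h3, mul_zero]⟩

/-- Rolle's theorem for polynomials over a real closed field. -/
theorem exists_derivative_eval_eq_zero {p : R[X]} (hp : p ≠ 0) {a b : R}
    (hab : a < b) (ha : p.eval a = 0) (hb : p.eval b = 0) :
    ∃ c, a < c ∧ c < b ∧ p.derivative.eval c = 0 := by
  classical
  let Z := p.roots.toFinset.filter fun c => a < c ∧ c ≤ b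
  have hbZ : b ∈ Z := by simp [Z, hab, hp, hb]
  have hmin := Z.min'_mem ⟨b, hbZ⟩
  set d := Z.min' ⟨b, hbZ⟩
  simp only [Z, Finset.mem_filter, Multiset.mem_toFinset, mem_roots hp, IsRoot.def] at hmin
  obtain ⟨c, h1, h2, h3⟩ := exists_derivative_eval_eq_zero_of_consecutive hp hmin.2.1 ha hmin.1
    fun c h1 h2 h3 => (Z.min'_le c (by
      simp [Z, hp, h1, h3, (h2.le.trans hmin.2.2)])).not_gt h2
  exact ⟨c, h1, h2.trans_le hmin.2.2, h3⟩

/-- A polynomial whose derivative has no root in `(a, b)` changes sign at a root in `(a, b)`. -/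
theorem eval_mul_eval_neg_of_root {p : R[X]} {a b r : R} (har : a < r) (hrb : r < b)
    (hr : p.eval r = 0) (hder : ∀ c, a < c → c < b → p.derivative.eval c ≠ 0) :
    p.eval a * p.eval b < 0 := by
  have hp : p ≠ 0 := by rintro rfl; exact hder r har hrb (by simp)
  obtain ⟨q, rfl⟩ := dvd_iff_isRoot.2 hr
  have hqr : q.eval r ≠ 0 := by
    have := hder r har hrb
    simpa [derivative_mul] using this
  -- A second root of `p` in [a, b] would give a root of the derivative by Rolle; `r` itself is a
  -- simple root.
  have hq : ∀ c, a ≤ c → c ≤ b → q.eval c ≠ 0 := fun c h1 h2 h3 => by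
    have hc : ((X - C r) * q).eval c = 0 := by simp [h3]
    rcases lt_trichotomy c r with h | h | h
    · obtain ⟨d, hd1, hd2, hd3⟩ := exists_derivative_eval_eq_zero hp h hc hr
      exact hder d (h1.trans_lt hd1) (hd2.trans hrb) hd3
    · exact hqr (h ▸ h3)
    · obtain ⟨d, hd1, hd2, hd3⟩ := exists_derivative_eval_eq_zero hp h hr hc
      exact hder d (har.trans hd1) (hd2.trans_le h2) hd3
  have hpos := eval_mul_eval_pos (har.trans hrb).le hq
  have : 0 < (r - a) * (b - r) * (q.eval a * q.eval b) :=
    mul_pos (mul_pos (sub_pos.2 har) (sub_pos.2 hrb)) hpos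
  simp only [eval_mul, eval_sub, eval_X, eval_C]
  linear_combination this

end IsRealClosed

/-! ### Relative real closure as a matroid closure -/

section RealClosureIn

open AlgebraicIndependent

variable {L : Type u} [Field L]

theorem isAlgebraic_of_le {R₁ R₂ : Type*} [SetLike R₁ L] [SubringClass R₁ L] [SetLike R₂ L]
    [SubringClass R₂ L] {A : R₁} {B : R₂} (h : ∀ x ∈ A, x ∈ B) {x : L} (hx : IsAlgebraic A x) :
    IsAlgebraic B x := by
  let f : A →+* B := ⟨⟨⟨fun a => ⟨a, h _ a.2⟩, rfl⟩, fun _ _ => rfl⟩, rfl, fun _ _ => rfl⟩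
  let : Algebra A B := f.toAlgebra
  have : IsScalarTower A B L := IsScalarTower.of_algebraMap_eq fun _ => rfl
  exact hx.extendScalars (R := A) fun a b hab => Subtype.ext (congrArg (fun z : B => (z : L)) hab)

/-- Identifies the real closure with the closure of the algebraic-independence matroid, which
supplies idempotence, exchange and finite character. -/
theorem realClosureIn_eq_closure [CharZero L] (S : Set L) :
    realClosureIn S = (matroid ℤ L).closure S := by
  have hsub : ∀ T : Set L, (matroid ℤ L).closure T ⊆ realClosureIn T := fun T x hx => by
    rw [matroid_closure_eq] at hx
    refine isAlgebraic_of_le (fun y hy => ?_) hx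
    exact Algebra.adjoin_le (S := subalgebraOfSubring (Subfield.closure T).toSubring)
      Subfield.subset_closure hy
  refine Set.Subset.antisymm (fun x hx => ?_) (hsub S)
  have h1 : (Subfield.closure S : Set L) ⊆ (matroid ℤ L).closure S := by
    rw [matroid_closure_eq]
    intro y hy
    induction hy using Subfield.closure_induction with
    | mem x hx => exact isAlgebraic_algebraMap (⟨x, Algebra.subset_adjoin hx⟩ : Algebra.adjoin ℤ S)
    | one => exact one_mem _
    | add x y _ _ hx hy => exact add_mem hx hy
    | neg x _ hx => exact neg_mem hx
    | inv x _ hx => exact IsAlgebraic.inv hx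
    | mul x y _ _ hx hy => exact mul_mem hx hy
  have h2 : x ∈ (matroid ℤ L).closure (Subfield.closure S : Set L) := by
    rw [matroid_closure_eq]
    exact isAlgebraic_of_le (fun y hy => Algebra.subset_adjoin hy) hx
  exact Matroid.closure_subset_closure_of_subset_closure h1 h2

theorem subset_realClosureIn (S : Set L) : S ⊆ realClosureIn S := fun x hx =>
  isAlgebraic_algebraMap (⟨x, Subfield.subset_closure hx⟩ : Subfield.closure S)

theorem realClosureIn_mono {S T : Set L} (h : S ⊆ T) : realClosureIn S ⊆ realClosureIn T :=
  fun _ hx => isAlgebraic_of_le (fun _ hy => Subfield.closure_mono h hy) hx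

theorem realClosureIn_subset [CharZero L] {S T : Set L} (h : S ⊆ realClosureIn T) :
    realClosureIn S ⊆ realClosureIn T := by
  rw [realClosureIn_eq_closure] at *
  rw [realClosureIn_eq_closure]
  exact Matroid.closure_subset_closure_of_subset_closure h

theorem realClosureIn_realClosureIn [CharZero L] (S : Set L) :
    realClosureIn (realClosureIn S) = realClosureIn S :=
  (realClosureIn_subset subset_rfl).antisymm (subset_realClosureIn _)

theorem realClosureIn_realClosureIn_union [CharZero L] (S T : Set L) :
    realClosureIn (realClosureIn S ∪ T) = realClosureIn (S ∪ T) := by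
  simp only [realClosureIn_eq_closure, Matroid.closure_union_closure_left_eq]

theorem realClosureIn_exchange [CharZero L] {S : Set L} {x y : L}
    (hx : x ∈ realClosureIn (insert y S)) (hx' : x ∉ realClosureIn S) :
    y ∈ realClosureIn (insert x S) := by
  rw [realClosureIn_eq_closure] at *
  exact (Matroid.closure_exchange ⟨hx, hx'⟩).1

theorem exists_finite_mem_realClosureIn [CharZero L] {S : Set L} {x : L}
    (hx : x ∈ realClosureIn S) : ∃ T ⊆ S, T.Finite ∧ x ∈ realClosureIn T := by
  rw [realClosureIn_eq_closure] at hx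
  obtain ⟨T, h1, h2, -, h3⟩ := Matroid.exists_mem_finite_closure_of_mem_closure hx
  exact ⟨T, h1, h2, by rwa [realClosureIn_eq_closure]⟩

theorem exists_finite_mem_realClosureIn_union [CharZero L] {F S : Set L} {x : L}
    (hx : x ∈ realClosureIn (F ∪ S)) : ∃ T ⊆ S, T.Finite ∧ x ∈ realClosureIn (F ∪ T) := by
  obtain ⟨T, h1, h2, h3⟩ := exists_finite_mem_realClosureIn hx
  refine ⟨T ∩ S, Set.inter_subset_right, h2.inter_of_left _, realClosureIn_mono (fun y hy => ?_) h3⟩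
  rcases h1 hy with h | h
  · exact .inl h
  · exact .inr ⟨hy, h⟩

/-- The real closure of the field generated by `S`, as a subfield. -/
noncomputable def realClosureField (S : Set L) : Subfield L :=
  (algebraicClosure (Subfield.closure S) L).toSubfield

theorem mem_realClosureField {S : Set L} {x : L} : x ∈ realClosureField S ↔ x ∈ realClosureIn S :=
  mem_algebraicClosure_iff

@[simp]
theorem coe_realClosureField (S : Set L) : (realClosureField S : Set L) = realClosureIn S :=
  Set.ext fun _ => mem_realClosureField

theorem le_realClosureField_union (F : Subfield L) (S : Set L) :
    F ≤ realClosureField ((F : Set L) ∪ S) := fun _ hz =>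
  mem_realClosureField.2 (subset_realClosureIn _ (Or.inl hz))

/-- The subfield `F` is algebraically closed in `L`. -/
def IsRelClosed (F : Subfield L) : Prop := realClosureIn (F : Set L) ⊆ F

theorem isRelClosed_realClosureField [CharZero L] (S : Set L) :
    IsRelClosed (realClosureField S) := by
  rw [IsRelClosed, coe_realClosureField, realClosureIn_realClosureIn]

theorem IsRelClosed.eq {F : Subfield L} (hF : IsRelClosed F) : realClosureIn (F : Set L) = F :=
  Set.Subset.antisymm hF (subset_realClosureIn _)

open Polynomial in
theorem mem_realClosureIn_of_eval {S : Set L} {p : L[X]} (hp : p ≠ 0)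
    (hS : ∀ n, p.coeff n ∈ Subfield.closure S) {x : L} (hx : p.eval x = 0) :
    x ∈ realClosureIn S := by
  obtain ⟨q, rfl⟩ := (lifts_iff_coeff_lifts (f := (Subfield.closure S).subtype) p).2
    (fun n => ⟨⟨_, hS n⟩, rfl⟩)
  exact ⟨q, by rintro rfl; simp at hp, by rwa [coe_mapRingHom, eval_map] at hx⟩

open Polynomial in
theorem IsRelClosed.mem_of_eval {F : Subfield L} (hF : IsRelClosed F) {p : F[X]} (hp : p ≠ 0)
    {x : L} (hx : aeval x p = 0) : x ∈ F := by
  refine hF (mem_realClosureIn_of_eval (p := p.map F.subtype) (Polynomial.map_ne_zero hp) ?_ ?_)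
  · intro n
    rw [coeff_map, Subfield.closure_eq]
    exact (p.coeff n).2
  · rwa [eval_map]

-- Algebraicity over F(b) is algebraicity over the ring F[b]; the coefficients lift along F[X] →
-- F[b]. Nonvanishing is asserted after substituting `b`, since `b` may be algebraic over `F`.
open Polynomial in
theorem exists_bivariate_of_mem_realClosureIn [CharZero L] {F : Subfield L} {b x : L}
    (hx : x ∈ realClosureIn (insert b (F : Set L))) :
    ∃ Q : F[X][X], Q.map (aeval b : F[X] →ₐ[F] L).toRingHom ≠ 0 ∧
      (Q.map (aeval b : F[X] →ₐ[F] L).toRingHom).eval x = 0 := by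
  rw [realClosureIn_eq_closure, matroid_closure_eq] at hx
  have hx' : IsAlgebraic (aeval b : F[X] →ₐ[F] L).toRingHom.range x := by
    refine isAlgebraic_of_le (fun y hy => ?_) hx
    refine Algebra.adjoin_le (S := subalgebraOfSubring
      (aeval b : F[X] →ₐ[F] L).toRingHom.range) ?_ hy
    rintro z (rfl | hz)
    · exact ⟨X, by simp⟩
    · exact ⟨C ⟨z, hz⟩, by simp; rfl⟩
  obtain ⟨p, hp, hpx⟩ := hx'
  obtain ⟨Q, rfl⟩ := Polynomial.map_surjective
    (aeval b : F[X] →ₐ[F] L).toRingHom.rangeRestrict (RingHom.rangeRestrict_surjective _) p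
  have hcomp : (aeval b : F[X] →ₐ[F] L).toRingHom =
    (algebraMap (aeval b : F[X] →ₐ[F] L).toRingHom.range L).comp
      (aeval b : F[X] →ₐ[F] L).toRingHom.rangeRestrict := rfl
  refine ⟨Q, ?_, ?_⟩
  · rw [hcomp, ← Polynomial.map_map]
    exact (Polynomial.map_ne_zero_iff Subtype.val_injective).2 hp
  · rw [hcomp, ← Polynomial.map_map, eval_map_algebraMap]
    exact hpx

open Polynomial in
theorem mem_realClosureIn_of_bivariate {F : Subfield L} {b x : L} {Q : F[X][X]}
    (hQ : Q.map (aeval b : F[X] →ₐ[F] L).toRingHom ≠ 0)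
    (hx : (Q.map (aeval b : F[X] →ₐ[F] L).toRingHom).eval x = 0) :
    x ∈ realClosureIn (insert b (F : Set L)) := by
  refine mem_realClosureIn_of_eval hQ (fun n => ?_) hx
  rw [coeff_map]
  change aeval b (Q.coeff n) ∈ _
  rw [aeval_eq_sum_range]
  refine sum_mem fun i _ => ?_
  rw [Algebra.smul_def]
  exact mul_mem (Subfield.subset_closure (.inr (SetLike.coe_mem _)))
    (pow_mem (Subfield.subset_closure (.inl rfl)) _)

theorem IsRelClosed.isRealClosed [LinearOrder L] [IsStrictOrderedRing L] [IsRealClosed L]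
    {F : Subfield L} (hF : IsRelClosed F) : IsRealClosed F := by
  refine .of_linearOrderedField (fun {x} hx => ?_) (fun {f} hf => ?_)
  · obtain ⟨y, hy⟩ := IsSquare.of_nonneg (show (0 : L) ≤ x from hx)
    have : y ∈ F := hF.mem_of_eval (p := Polynomial.X ^ 2 - Polynomial.C x)
      (Polynomial.X_pow_sub_C_ne_zero two_pos x) (by
        simp only [map_sub, map_pow, Polynomial.aeval_X, Polynomial.aeval_C]
        rw [show algebraMap F L x = (x : L) from rfl, hy]; ring)
    exact ⟨⟨y, this⟩, Subtype.ext hy⟩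
  · obtain ⟨y, hy⟩ := IsRealClosed.exists_isRoot_of_odd_natDegree
      (f := f.map (algebraMap F L)) (by rwa [Polynomial.natDegree_map])
    rw [Polynomial.IsRoot.def, Polynomial.eval_map_algebraMap] at hy
    have hf0 : f ≠ 0 := by rintro rfl; simp at hf
    refine ⟨⟨y, hF.mem_of_eval hf0 hy⟩, Subtype.ext ?_⟩
    have := Polynomial.aeval_algebraMap_apply L (⟨y, hF.mem_of_eval hf0 hy⟩ : F) f
    rw [Polynomial.coe_aeval_eq_eval] at this
    exact this.symm.trans hy

theorem isRelClosed_of_isRealClosed [LinearOrder L] [IsStrictOrderedRing L]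
    {F : Subfield L} [IsRealClosed F] : IsRelClosed F := by
  intro x hx
  rw [realClosureIn, Set.mem_ofPred_eq, Subfield.closure_eq] at hx
  obtain ⟨y, rfl⟩ := IsRealClosed.mem_range_of_isAlgebraic (fun _ _ h => h) hx
  exact y.2

end RealClosureIn

/-! ### Elements realizing the same cut -/

section SameCut

variable {K : Type u} [Field K] [LinearOrder K]

/-- The elements `x` and `y` realize the same cut of `G`. -/
def SameCut (G : Subfield K) (x y : K) : Prop :=
  ∀ g ∈ G, (g < x ↔ g < y) ∧ (x < g ↔ y < g)

variable {G H : Subfield K} {x y z : K}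

theorem SameCut.refl (G : Subfield K) (x : K) : SameCut G x x := fun _ _ => ⟨Iff.rfl, Iff.rfl⟩

theorem SameCut.symm (h : SameCut G x y) : SameCut G y x :=
  fun g hg => ⟨(h g hg).1.symm, (h g hg).2.symm⟩

theorem SameCut.trans (h : SameCut G x y) (h' : SameCut G y z) : SameCut G x z :=
  fun g hg => ⟨(h g hg).1.trans (h' g hg).1, (h g hg).2.trans (h' g hg).2⟩

theorem SameCut.mono (hGH : G ≤ H) (h : SameCut H x y) : SameCut G x y :=
  fun g hg => h g (hGH hg)

theorem SameCut.eq_of_mem (h : SameCut G x y) (hx : x ∈ G) : y = x := by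
  have := h x hx
  simp only [lt_self_iff_false, false_iff, not_lt] at this
  exact le_antisymm this.1 this.2

theorem SameCut.notMem (h : SameCut G x y) (hx : x ∉ G) : y ∉ G := fun hy =>
  hx (h.symm.eq_of_mem hy ▸ hy)

theorem SameCut.of_mem_Icc (h : SameCut G x y) (h1 : x ≤ z) (h2 : z ≤ y) : SameCut G x z :=
  fun g hg => ⟨⟨fun h' => h'.trans_le h1, fun h' => (h g hg).1.2 (h'.trans_le h2)⟩,
    ⟨fun h' => h2.trans_lt ((h g hg).2.1 h'), fun h' => h1.trans_lt h'⟩⟩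

theorem sameCut_of_forall_lt_iff (hx : x ∉ G) (hy : y ∉ G) (h : ∀ g ∈ G, g < x ↔ g < y) :
    SameCut G x y := fun g hg => by
  refine ⟨h g hg, ?_⟩
  have h1 : g ≠ x := fun e => hx (e ▸ hg)
  have h2 : g ≠ y := fun e => hy (e ▸ hg)
  have := h g hg
  constructor <;> intro h3
  · exact lt_of_le_of_ne (not_lt.1 fun h4 => h3.not_gt (this.2 h4)) h2.symm
  · exact lt_of_le_of_ne (not_lt.1 fun h4 => h3.not_gt (this.1 h4)) h1.symm

/-- A point outside the cut of `a` is cut off from `a` by an element of `G`; for finitely many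
points, shrink the interval once for each. -/
theorem exists_interval_avoiding {a p₀ q₀ : K} (ha : a ∉ G) (hp₀ : p₀ ∈ G) (hq₀ : q₀ ∈ G)
    (hpa : p₀ < a) (haq : a < q₀) (Z : Finset K) (hZ : ∀ z ∈ Z, ¬ SameCut G a z) :
    ∃ p ∈ G, ∃ q ∈ G, p₀ ≤ p ∧ p < a ∧ a < q ∧ q ≤ q₀ ∧ ∀ z ∈ Z, z ≤ p ∨ q ≤ z := by
  induction Z using Finset.induction_on with
  | empty => exact ⟨p₀, hp₀, q₀, hq₀, le_rfl, hpa, haq, le_rfl, by simp⟩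
  | insert w Z _ ih =>
    obtain ⟨p, hp, q, hq, h1, h2, h3, h4, h5⟩ := ih fun z hz => hZ z (Finset.mem_insert_of_mem hz)
    have hw := hZ w (Finset.mem_insert_self _ _)
    have key : (∃ g ∈ G, g < a ∧ w ≤ g) ∨ ∃ g ∈ G, a < g ∧ g ≤ w := by
      by_contra! hcon
      refine hw fun g hg => ⟨⟨fun h => hcon.1 g hg h, fun h => ?_⟩,
        ⟨fun h => hcon.2 g hg h, fun h => ?_⟩⟩
      · by_contra! hag
        rcases hag.eq_or_lt with rfl | hag
        · exact ha hg
        · exact (hcon.2 g hg hag).not_gt h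
      · by_contra! hag
        rcases hag.eq_or_lt with rfl | hag
        · exact ha hg
        · exact (hcon.1 g hg hag).not_gt h
    rcases key with ⟨g, hg, hga, hwg⟩ | ⟨g, hg, hag, hgw⟩
    · refine ⟨max p g, by rcases max_choice p g with h | h <;> rwa [h], q, hq,
        h1.trans (le_max_left _ _), max_lt h2 hga, h3, h4, ?_⟩
      intro z hz
      rcases Finset.mem_insert.1 hz with rfl | hz
      · exact .inl (hwg.trans (le_max_right _ _))
      · exact (h5 z hz).imp_left fun h => h.trans (le_max_left _ _)
    · refine ⟨p, hp, min q g, by rcases min_choice q g with h | h <;> rwa [h],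
        h1, h2, lt_min h3 hag, (min_le_left _ _).trans h4, ?_⟩
      intro z hz
      rcases Finset.mem_insert.1 hz with rfl | hz
      · exact .inr ((min_le_right _ _).trans hgw)
      · exact (h5 z hz).imp_right fun h => (min_le_left _ _).trans h

end SameCut

/-! ### Transporting realized cuts between elements in the same cut -/

section Transport

open Polynomial IsRealClosed

variable {K : Type u} [Field K] [LinearOrder K] [IsStrictOrderedRing K]
  {G : Subfield K} {b b' : K}

omit [LinearOrder K] [IsStrictOrderedRing K] in
theorem IsRelClosed.aeval_ne_zero (hG : IsRelClosed G) (hb : b ∉ G) {p : G[X]} (hp : p ≠ 0) :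
    aeval b p ≠ 0 := fun h => hb (hG.mem_of_eval hp h)

omit [IsStrictOrderedRing K] in
theorem IsRelClosed.map_ne_zero (hG : IsRelClosed G) (hb : b ∉ G) {Q : G[X][X]} (hQ : Q ≠ 0) :
    Q.map (aeval b : G[X] →ₐ[G] K).toRingHom ≠ 0 := by
  refine (Polynomial.map_ne_zero_iff ?_).2 hQ
  rw [injective_iff_map_eq_zero]
  intro p hp
  by_contra h
  exact hG.aeval_ne_zero hb h hp

variable [IsRealClosed K]

/-- A root of `p` between `b` and `b'` would lie in `G`, being algebraic over it, yet also in the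
cut of `b`, which `G` omits. -/
theorem SameCut.aeval_mul_aeval_pos (hG : IsRelClosed G) (hb : b ∉ G) (h : SameCut G b b')
    {p : G[X]} (hp : p ≠ 0) : 0 < aeval b p * aeval b' p := by
  wlog hle : b ≤ b' generalizing b b'
  · rw [mul_comm]
    exact this (h.notMem hb) h.symm (le_of_not_ge hle)
  rw [← eval_map_algebraMap, ← eval_map_algebraMap]
  refine eval_mul_eval_pos hle fun c h1 h2 h3 => ?_
  rw [eval_map_algebraMap] at h3
  exact (h.of_mem_Icc h1 h2).notMem hb (hG.mem_of_eval hp h3)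

omit [LinearOrder K] [IsStrictOrderedRing K] [IsRealClosed K] in
theorem eval_map_aeval (Q : G[X][X]) (b : K) {g : K} (hg : g ∈ G) :
    (Q.map (aeval b : G[X] →ₐ[G] K).toRingHom).eval g = aeval b (Q.eval (C ⟨g, hg⟩)) := by
  have : g = (aeval b : G[X] →ₐ[G] K).toRingHom (C ⟨g, hg⟩) := by simp; rfl
  conv_lhs => rw [this]
  rw [eval_map, eval₂_at_apply]
  rfl

/-- Induction on the degree of `Q` in the outer variable. If Q'(b, ·) has a root in the cut of `a`,
replace `a` by it. Otherwise Q(b, ·) changes sign across the cut between points of `G`; at such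
points the signs for `b` and `b'` agree, so Q(b', ·) has a root there too. -/
theorem exists_sameCut_of_bivariate (hG : IsRelClosed G) (hb : b ∉ G) (hbb' : SameCut G b b')
    {Q : G[X][X]} (hQ : Q ≠ 0) {a : K} (ha : a ∉ G) (hlow : ∃ p ∈ G, p < a) (hupp : ∃ q ∈ G, a < q)
    (haQ : (Q.map (aeval b : G[X] →ₐ[G] K).toRingHom).eval a = 0) :
    ∃ a' ∈ realClosureIn (insert b' (G : Set K)), SameCut G a a' := by
  have hb' := hbb'.notMem hb
  induction hn : Q.natDegree using Nat.strong_induction_on generalizing Q a with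
  | _ n ih =>
    subst hn
    have hdeg : Q.natDegree ≠ 0 := fun h0 => by
      rw [natDegree_eq_zero] at h0
      obtain ⟨q, rfl⟩ := h0
      rw [map_C, eval_C] at haQ
      exact hG.aeval_ne_zero hb (by rintro rfl; simp at hQ) haQ
    have hQ' : derivative Q ≠ 0 := fun h0 => hdeg (derivative_eq_zero.1 h0)
    by_cases hder : ∃ c, SameCut G a c ∧
        ((derivative Q).map (aeval b : G[X] →ₐ[G] K).toRingHom).eval c = 0
    · obtain ⟨c, hac, hc⟩ := hder
      obtain ⟨p, hp, hpa⟩ := hlow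
      obtain ⟨q, hq, hqa⟩ := hupp
      obtain ⟨a', ha', hca'⟩ := ih _ (natDegree_derivative_lt hdeg) hQ' (hac.notMem ha)
        ⟨p, hp, (hac p hp).1.1 hpa⟩ ⟨q, hq, (hac q hq).2.1 hqa⟩ hc rfl
      exact ⟨a', ha', hac.trans hca'⟩
    push Not at hder
    obtain ⟨p₀, hp₀, hpa₀⟩ := hlow
    obtain ⟨q₀, hq₀, hqa₀⟩ := hupp
    classical
    by_contra! hcon
    have hQb' := hG.map_ne_zero hb' hQ
    have hQ'b := hG.map_ne_zero hb hQ'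
    -- Under `hcon` the roots of Q(b', ·) also miss the cut of `a`, so one interval avoids them
    -- together with the roots of Q'(b, ·).
    obtain ⟨p, hp, q, hq, -, hpa, haq, -, hZ⟩ := exists_interval_avoiding ha hp₀ hq₀ hpa₀ hqa₀
      ((Q.map (aeval b' : G[X] →ₐ[G] K).toRingHom).roots.toFinset ∪
        ((derivative Q).map (aeval b : G[X] →ₐ[G] K).toRingHom).roots.toFinset) (by
        intro z hz
        rw [Finset.mem_union, Multiset.mem_toFinset, Multiset.mem_toFinset, mem_roots hQb',
          mem_roots hQ'b] at hz
        rcases hz with hz | hz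
        · exact hcon z (mem_realClosureIn_of_bivariate hQb' hz)
        · exact fun h => hder z h hz)
    have hneg := eval_mul_eval_neg_of_root hpa haq haQ (by
      intro c h1 h2 h3
      rw [derivative_map] at h3
      rcases hZ c (by
        rw [Finset.mem_union, Multiset.mem_toFinset, Multiset.mem_toFinset, mem_roots hQ'b]
        exact .inr h3) with h | h
      · exact h.not_gt h1
      · exact h.not_gt h2)
    rw [eval_map_aeval Q b hp, eval_map_aeval Q b hq] at hneg
    set u := Q.eval (C ⟨p, hp⟩)
    set v := Q.eval (C ⟨q, hq⟩)
    have hu : u ≠ 0 := fun h => by simp [h] at hneg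
    have hv : v ≠ 0 := fun h => by simp [h] at hneg
    have hu' := hbb'.aeval_mul_aeval_pos hG hb hu
    have hv' := hbb'.aeval_mul_aeval_pos hG hb hv
    have hneg' : aeval b' u * aeval b' v < 0 := by
      by_contra! h
      have := mul_nonpos_of_nonpos_of_nonneg hneg.le h
      have h2 := mul_pos hu' hv'
      linarith [this, h2, show aeval b u * aeval b' u * (aeval b v * aeval b' v) =
        aeval b u * aeval b v * (aeval b' u * aeval b' v) by ring]
    rw [← eval_map_aeval Q b' hp, ← eval_map_aeval Q b' hq] at hneg'
    obtain ⟨c, h1, h2, h3⟩ := exists_isRoot_of_eval_mul_eval_neg (hpa.trans haq).le hneg'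
    rcases hZ c (by
      rw [Finset.mem_union, Multiset.mem_toFinset, Multiset.mem_toFinset, mem_roots hQb']
      exact .inl h3) with h | h
    · exact h.not_gt h1
    · exact h.not_gt h2

omit [LinearOrder K] [IsStrictOrderedRing K] [IsRealClosed K] in
theorem inv_mem_realClosureIn {S : Set K} {x : K} (hx : x ∈ realClosureIn S) :
    x⁻¹ ∈ realClosureIn S := by
  rw [← mem_realClosureField] at *
  exact inv_mem hx

omit [IsRealClosed K] in
theorem SameCut.inv {x y : K} (h : SameCut G x y) (hx : x ∉ G) : SameCut G x⁻¹ y⁻¹ := by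
  have hy := h.notMem hx
  have hinv : ∀ {z : K}, z ∉ G → z⁻¹ ∉ G := fun hz h => hz (by simpa using inv_mem h)
  have hx0 : x ≠ 0 := fun e => hx (e ▸ zero_mem G)
  have hy0 : y ≠ 0 := fun e => hy (e ▸ zero_mem G)
  refine sameCut_of_forall_lt_iff (hinv hx) (hinv hy) fun g hg => ?_
  have h0 := h 0 (zero_mem G)
  have hg' := h g⁻¹ (inv_mem hg)
  rcases lt_or_gt_of_ne hx0 with hx1 | hx1
  · have hy1 := h0.2.1 hx1
    rcases lt_or_ge g 0 with hg0 | hg0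
    · rw [lt_inv_of_neg hg0 hx1, lt_inv_of_neg hg0 hy1]
      exact hg'.2
    · exact iff_of_false (not_lt.2 ((inv_neg''.2 hx1).le.trans hg0))
        (not_lt.2 ((inv_neg''.2 hy1).le.trans hg0))
  · have hy1 := h0.1.1 hx1
    rcases lt_or_ge 0 g with hg0 | hg0
    · rw [lt_inv_comm₀ hg0 hx1, lt_inv_comm₀ hg0 hy1]
      exact hg'.2
    · exact iff_of_true (hg0.trans_lt (inv_pos.2 hx1)) (hg0.trans_lt (inv_pos.2 hy1))

/-- If `b` and `b'` realize the same cut of the relatively closed subfield `G`, then every cut of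
`G` realized in the real closure of `G(b)` is realized in the real closure of `G(b')`. -/
theorem SameCut.exists_mem_realClosureIn (hG : IsRelClosed G) (hb : b ∉ G) (hbb' : SameCut G b b')
    {a : K} (ha : a ∉ G) (hab : a ∈ realClosureIn (insert b (G : Set K))) :
    ∃ a' ∈ realClosureIn (insert b' (G : Set K)), SameCut G a a' := by
  have key : ∀ a ∉ G, a ∈ realClosureIn (insert b (G : Set K)) → (∃ p ∈ G, p < a) →
      (∃ q ∈ G, a < q) → ∃ a' ∈ realClosureIn (insert b' (G : Set K)), SameCut G a a' := by
    intro a ha hab h1 h2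
    obtain ⟨Q, hQ, hQa⟩ := exists_bivariate_of_mem_realClosureIn hab
    exact exists_sameCut_of_bivariate hG hb hbb' (by rintro rfl; simp at hQ) ha h1 h2 hQa
  by_cases hbdd : (∃ p ∈ G, p < a) ∧ ∃ q ∈ G, a < q
  · exact key a ha hab hbdd.1 hbdd.2
  -- When `a` is not bounded on both sides by `G`, necessarily |a| ≥ 1, so the inverse is bounded
  -- and the first case applies to it.
  have ha' : a⁻¹ ∉ G := fun h => ha (inv_inv a ▸ inv_mem h)
  have hbd : |a⁻¹| ≤ 1 := by
    rw [abs_inv]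
    refine inv_le_one_of_one_le₀ ?_
    by_contra! hlt
    rw [abs_lt] at hlt
    exact hbdd ⟨⟨-1, neg_mem (one_mem G), hlt.1⟩, 1, one_mem G, hlt.2⟩
  rw [abs_le] at hbd
  obtain ⟨c, hc, hac⟩ := key a⁻¹ ha' (inv_mem_realClosureIn hab)
    ⟨-1 - 1, sub_mem (neg_mem (one_mem G)) (one_mem G), by linarith⟩
    ⟨1 + 1, add_mem (one_mem G) (one_mem G), by linarith⟩
  refine ⟨c⁻¹, inv_mem_realClosureIn hc, ?_⟩
  simpa using hac.inv ha'

end Transport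

/-! ### Independence of cuts in terms of realizing elements -/

section Independent

variable {K : Type u} [Field K] [LinearOrder K]

/-- No element `x` of `A` has its cut over `F` realized in the real closure of the field generated
by `F` and the other elements of `A`. -/
def CutIndep (F : Subfield K) (A : Set K) : Prop :=
  ∀ x ∈ A, ∀ y ∈ realClosureIn ((F : Set K) ∪ (A \ {x})), ¬ SameCut F x y

variable [IsStrictOrderedRing K] {F : Subfield K} {A : Set K}

/-- Cuts of the larger field refine cuts of `F`, so a violation over it is already one over `F`. -/
theorem CutIndep.adjoin (h : CutIndep F A) {R : Set K} (hR : R ⊆ A) :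
    CutIndep (realClosureField ((F : Set K) ∪ R)) (A \ R) := by
  intro x hx y hy hxy
  rw [coe_realClosureField, realClosureIn_realClosureIn_union] at hy
  refine h x hx.1 y (realClosureIn_mono ?_ hy) (hxy.mono (le_realClosureField_union F R))
  rintro z ((hz | hz) | hz)
  · exact .inl hz
  · exact .inr ⟨hR hz, fun e => hx.2 (e ▸ hz)⟩
  · exact .inr ⟨hz.1.1, hz.2⟩

/-- A cut of `F` that is realized over two disjoint sets of members of an independent set is not
realized outside `F`. -/
theorem CutIndep.mem_of_sameCut [IsRealClosed K] (hF : IsRelClosed F) (h : CutIndep F A)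
    {S T : Set K} (hS : S ⊆ A) (hT : T ⊆ A) (hST : Disjoint S T) (hfin : S.Finite) {x y : K}
    (hx : x ∈ realClosureIn ((F : Set K) ∪ S)) (hy : y ∈ realClosureIn ((F : Set K) ∪ T))
    (hxy : SameCut F x y) : y ∈ F := by
  induction S, hfin using Set.Finite.induction_on generalizing x with
  | empty =>
    rw [Set.union_empty] at hx
    have := hF hx
    rwa [hxy.eq_of_mem this]
  | @insert s S hs _ ih =>
    have ih' := fun x hx hxy => @ih ((Set.subset_insert s S).trans hS)
      (hST.mono_left (Set.subset_insert s S)) x hx hxy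
    set G := realClosureField ((F : Set K) ∪ S) with hGdef
    have hFG : F ≤ G := le_realClosureField_union F S
    have hG : IsRelClosed G := isRelClosed_realClosureField _
    by_contra hyF
    -- By induction `G` misses this cut of `F`, so no element of `G` separates `x` from `y`: they
    -- share a cut of `G` as well.
    have hnot : ∀ z ∈ G, ¬ SameCut F x z := fun z hz hxz =>
      hyF (ih' z (mem_realClosureField.1 hz) (hxz.symm.trans hxy))
    have hxG : x ∉ G := fun hxG => hnot x hxG (.refl F x)
    have hyG : y ∉ G := fun hyG => hnot y hyG hxy
    have hxyG : SameCut G x y := by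
      refine sameCut_of_forall_lt_iff hxG hyG fun g hg => ⟨fun h1 => ?_, fun h1 => ?_⟩
      · by_contra! h2
        exact hnot g hg (hxy.trans (hxy.symm.of_mem_Icc h2 h1.le))
      · by_contra! h2
        exact hnot g hg (hxy.of_mem_Icc h2 h1.le)
    rw [Set.union_insert] at hx
    -- By exchange `s` lies in the real closure of G(x); transport to G(y) then realizes the cut of
    -- `s` without using `s`.
    have hsx := realClosureIn_exchange hx fun h => hxG (mem_realClosureField.2 h)
    have hsG : s ∉ G := fun hsG => hxG (mem_realClosureField.2 (realClosureIn_subset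
      (Set.insert_subset (mem_realClosureField.1 hsG) (subset_realClosureIn _)) hx))
    obtain ⟨a', ha', hsa'⟩ := hxyG.exists_mem_realClosureIn hG hxG hsG
      (realClosureIn_mono (Set.insert_subset_insert (by
        rw [hGdef, coe_realClosureField]; exact subset_realClosureIn _)) hsx)
    have hTA : T ⊆ A \ {s} := fun t ht =>
      ⟨hT ht, fun e => Set.disjoint_left.1 hST (Set.mem_insert _ _) (e ▸ ht)⟩
    have hSA : S ⊆ A \ {s} := fun t ht => ⟨hS (Set.mem_insert_of_mem _ ht), fun e => hs (e ▸ ht)⟩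
    refine h s (hS (Set.mem_insert s S)) a' ?_ (hsa'.mono hFG)
    refine realClosureIn_subset (Set.insert_subset ?_ ?_) ha'
    · exact realClosureIn_mono (Set.union_subset_union_right _ hTA) hy
    · rw [hGdef, coe_realClosureField]
      exact realClosureIn_mono (Set.union_subset_union_right _ hSA)

end Independent

/-! ### Thin sets -/

section Thin

variable {K : Type u} [LinearOrder K] {κ : Cardinal.{u}}

/-- Every subset of `X` has a cofinal subset of cardinality at most `κ`. -/
def Thin (κ : Cardinal.{u}) (X : Set K) : Prop :=
  ∀ S ⊆ X, ∃ T ⊆ S, #T ≤ κ ∧ ∀ s ∈ S, ∃ t ∈ T, s ≤ t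

theorem thin_of_countable (hκ : ℵ₀ ≤ κ) {X : Set K} (hX : X.Countable) : Thin κ X :=
  fun S hS => ⟨S, subset_rfl, (le_aleph0_iff_set_countable.2 (hX.mono hS)).trans hκ,
    fun s hs => ⟨s, hs, le_rfl⟩⟩

theorem Thin.iUnion (hκ : ℵ₀ ≤ κ) {ι : Type u} (hι : #ι ≤ κ) {X : ι → Set K}
    (hX : ∀ i, Thin κ (X i)) : Thin κ (⋃ i, X i) := by
  intro S hS
  choose T hT hTκ hTS using fun i => hX i (S ∩ X i) Set.inter_subset_right
  refine ⟨⋃ i, T i, Set.iUnion_subset fun i => (hT i).trans Set.inter_subset_left, ?_, ?_⟩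
  · refine (mk_iUnion_le _).trans ?_
    exact (mul_le_mul' hι (ciSup_le' hTκ)).trans (mul_eq_self hκ).le
  · intro s hs
    obtain ⟨i, hi⟩ := Set.mem_iUnion.1 (hS hs)
    obtain ⟨t, ht, hst⟩ := hTS i s ⟨hs, hi⟩
    exact ⟨t, Set.mem_iUnion.2 ⟨i, ht⟩, hst⟩

theorem Thin.exists_of_image {X : Set K} (hX : Thin κ X) {α : Type u} (D : Set α) (f : α → K)
    (hf : ∀ x ∈ D, f x ∈ X) : ∃ D' ⊆ D, #D' ≤ κ ∧ ∀ x ∈ D, ∃ x' ∈ D', f x ≤ f x' := by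
  obtain ⟨T, hT, hTκ, hTS⟩ := hX (f '' D) (by rintro _ ⟨x, hx, rfl⟩; exact hf x hx)
  rcases isEmpty_or_nonempty α with _ | _
  · exact ⟨D, subset_rfl, by simp, fun x => isEmptyElim x⟩
  replace hT : ∀ t ∈ T, ∃ x ∈ D, f x = t := fun t ht => hT ht
  choose! g hg hfg using hT
  refine ⟨g '' T, ?_, mk_image_le.trans hTκ, fun x hx => ?_⟩
  · rintro _ ⟨t, ht, rfl⟩
    exact hg t ht
  · obtain ⟨t, ht, hxt⟩ := hTS _ ⟨x, hx, rfl⟩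
    exact ⟨g t, ⟨t, ht, rfl⟩, by rwa [hfg t ht]⟩

/-- Colouring by countably many values costs nothing: choose cofinal sets colour by colour. -/
theorem Thin.exists_of_fibers (hκ : ℵ₀ ≤ κ) {X : Set K} (hX : Thin κ X) {α ι : Type u} (D : Set α)
    (f : α → K) (hf : ∀ x ∈ D, f x ∈ X) (c : α → ι) (hc : (c '' D).Countable) :
    ∃ D' ⊆ D, #D' ≤ κ ∧ ∀ x ∈ D, ∃ x' ∈ D', c x = c x' ∧ f x ≤ f x' := by
  choose D' hD' hD'κ hD'D using fun i : c '' D =>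
    hX.exists_of_image (D ∩ c ⁻¹' {i.1}) f fun x hx => hf x hx.1
  refine ⟨⋃ i, D' i, Set.iUnion_subset fun i => (hD' i).trans Set.inter_subset_left, ?_, ?_⟩
  · refine (mk_iUnion_le _).trans ?_
    exact (mul_le_mul' ((le_aleph0_iff_set_countable.2 hc).trans hκ) (ciSup_le' hD'κ)).trans
      (mul_eq_self hκ).le
  · intro x hx
    obtain ⟨x', hx', hle⟩ := hD'D ⟨c x, x, hx, rfl⟩ x ⟨hx, rfl⟩
    exact ⟨x', Set.mem_iUnion.2 ⟨_, hx'⟩, (hD' _ hx').2.symm, hle⟩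

/-- A set is not thin as soon as it has a subset all of whose small subsets are bounded in it. -/
theorem exists_of_not_thin {X : Set K} (hX : ¬ Thin κ X) :
    ∃ S ⊆ X, ∀ T ⊆ S, #T ≤ κ → ∃ s ∈ S, ∀ t ∈ T, t < s := by
  simp only [Thin] at hX
  push Not at hX
  obtain ⟨S, hS, h⟩ := hX
  exact ⟨S, hS, h⟩

end Thin

/-! ### Thinness from archimedean classes -/

section ThinClasses

open ArchimedeanClass

variable {K : Type u} [Field K] [LinearOrder K] [IsStrictOrderedRing K] {κ : Cardinal.{u}}

theorem mk_le_mk_of_pos_of_le {x y : K} (hx : 0 ≤ x) (hxy : x ≤ y) :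
    ArchimedeanClass.mk y ≤ ArchimedeanClass.mk x :=
  mk_antitoneOn hx (hx.trans hxy) hxy

variable {S : Set K}

/-- Larger positive elements have smaller classes, so the class of t − s decreases as t grows; `h`
is taken beyond s + d for a small set of differences d whose classes are coinitial. -/
theorem exists_eventual_class (hκ : ℵ₀ ≤ κ)
    (hS : ∀ T ⊆ S, #T ≤ κ → ∃ s ∈ S, ∀ t ∈ T, t < s)
    (h1 : ∀ D : Set K, (∀ d ∈ D, ∃ s ∈ S, ∃ t ∈ S, s < t ∧ d = t - s) →
      ∃ T ⊆ D, #T ≤ κ ∧ ∀ d ∈ D, ∃ t ∈ T, ArchimedeanClass.mk t ≤ ArchimedeanClass.mk d)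
    {s : K} (hs : s ∈ S) :
    ∃ h ∈ S, s < h ∧ ∀ t ∈ S, h ≤ t → ArchimedeanClass.mk (t - s) = ArchimedeanClass.mk (h - s) := by
  obtain ⟨T, hT, hTκ, hTD⟩ := h1 {d | ∃ t ∈ S, s < t ∧ d = t - s}
    (by rintro d ⟨t, ht, hst, rfl⟩; exact ⟨s, hs, t, ht, hst, rfl⟩)
  obtain ⟨h, hhS, hh⟩ := hS (insert s ((s + ·) '' T)) (by
    refine Set.insert_subset hs ?_
    rintro _ ⟨d, hd, rfl⟩
    obtain ⟨t, ht, -, rfl⟩ := hT hd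
    simpa using ht) (by
    refine (mk_insert_le).trans (add_le_of_le hκ (mk_image_le.trans hTκ) (one_le_aleph0.trans hκ)))
  have hsh := hh s (Set.mem_insert _ _)
  refine ⟨h, hhS, hsh, fun t ht hht => le_antisymm
    (mk_le_mk_of_pos_of_le (by linarith) (by linarith)) ?_⟩
  obtain ⟨d, hd, hle⟩ := hTD (t - s) ⟨t, ht, hsh.trans_le hht, rfl⟩
  refine le_trans (mk_le_mk_of_pos_of_le ?_ ?_) hle
  · obtain ⟨t', -, hst', rfl⟩ := hT hd
    linarith
  · have := hh (s + d) (Set.mem_insert_of_mem _ ⟨d, hd, rfl⟩)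
    linarith

/-- The eventual class of t − s increases with s; past a small set of points s on which it is
cofinal, it is constant. -/
theorem exists_constant_class (hκ : ℵ₀ ≤ κ)
    (hS : ∀ T ⊆ S, #T ≤ κ → ∃ s ∈ S, ∀ t ∈ T, t < s)
    (h1 : ∀ D : Set K, (∀ d ∈ D, ∃ s ∈ S, ∃ t ∈ S, s < t ∧ d = t - s) →
      ∃ T ⊆ D, #T ≤ κ ∧ ∀ d ∈ D, ∃ t ∈ T, ArchimedeanClass.mk t ≤ ArchimedeanClass.mk d)
    (h2 : ∀ D : Set K, (∀ d ∈ D, ∃ s ∈ S, ∃ t ∈ S, s < t ∧ d = t - s) →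
      ∃ T ⊆ D, #T ≤ κ ∧ ∀ d ∈ D, ∃ t ∈ T, ArchimedeanClass.mk d ≤ ArchimedeanClass.mk t) :
    ∃ s₀ ∈ S, ∃ u > 0, ∀ s ∈ S, s₀ ≤ s → ∃ h ∈ S, s < h ∧
      ∀ t ∈ S, h ≤ t → ArchimedeanClass.mk (t - s) = ArchimedeanClass.mk u := by
  choose! h hhS hsh hh using fun s hs => exists_eventual_class hκ hS h1 (s := s) hs
  obtain ⟨T, hT, hTκ, hTD⟩ := h2 ((fun s => h s - s) '' S) (by
    rintro _ ⟨s, hs, rfl⟩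
    exact ⟨s, hs, h s, hhS s hs, hsh s hs, rfl⟩)
  replace hT : ∀ t ∈ T, ∃ s ∈ S, h s - s = t := fun t ht => hT ht
  choose! g hgS hg using hT
  obtain ⟨s₀, hs₀, hlt⟩ := hS (g '' T) (by rintro _ ⟨t, ht, rfl⟩; exact hgS t ht)
    (mk_image_le.trans hTκ)
  refine ⟨s₀, hs₀, h s₀ - s₀, sub_pos.2 (hsh _ hs₀), fun s hs hle =>
    ⟨h s, hhS s hs, hsh s hs, fun t ht hst => ?_⟩⟩
  rw [hh s hs t ht hst]
  obtain ⟨d, hd, hle'⟩ := hTD _ ⟨s, hs, rfl⟩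
  have hgd := hgS d hd
  have hlt' := hlt _ ⟨d, hd, rfl⟩
  have hdeq : h (g d) - g d = d := hg d hd
  rw [← hdeq] at hle'
  obtain ⟨m, hm, hm1, hm2, hm3⟩ : ∃ m ∈ S, h s ≤ m ∧ h (g d) ≤ m ∧ h s₀ ≤ m := by
    refine ⟨max (h s) (max (h (g d)) (h s₀)), ?_, le_max_left _ _,
      (le_max_left _ _).trans (le_max_right _ _), (le_max_right _ _).trans (le_max_right _ _)⟩
    rcases max_choice (h s) (max (h (g d)) (h s₀)) with e | e <;> rw [e]
    · exact hhS s hs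
    · rcases max_choice (h (g d)) (h s₀) with e | e <;> rw [e]
      · exact hhS _ hgd
      · exact hhS _ hs₀
  have hms := hsh s hs
  rw [← hh s hs m hm hm1, ← hh _ hgd m hm hm2] at hle'
  rw [← hh s hs m hm hm1, ← hh _ hs₀ m hm hm3]
  have e1 : ArchimedeanClass.mk (m - s₀) ≤ ArchimedeanClass.mk (m - s) :=
    mk_le_mk_of_pos_of_le (by linarith) (by linarith)
  have e2 : ArchimedeanClass.mk (m - g d) ≤ ArchimedeanClass.mk (m - s₀) :=
    mk_le_mk_of_pos_of_le (by linarith) (by linarith)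
  exact le_antisymm (hle'.trans e2) e1

/-- In a counterexample all eventual differences beyond s₀ are comparable to one u. The countably
many points s₀ + qu, q rational, then separate elements of S arbitrarily far out, although some s in
S lies beyond all those that S reaches. -/
theorem thin_of_classes (hκ : ℵ₀ ≤ κ) {G : Subfield K}
    (h1 : ∀ D ⊆ (G : Set K), (∀ d ∈ D, 0 < d) →
      ∃ T ⊆ D, #T ≤ κ ∧ ∀ d ∈ D, ∃ t ∈ T, ArchimedeanClass.mk t ≤ ArchimedeanClass.mk d)
    (h2 : ∀ D ⊆ (G : Set K), (∀ d ∈ D, 0 < d) →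
      ∃ T ⊆ D, #T ≤ κ ∧ ∀ d ∈ D, ∃ t ∈ T, ArchimedeanClass.mk d ≤ ArchimedeanClass.mk t) :
    Thin κ (G : Set K) := by
  by_contra hG
  obtain ⟨S, hSG, hS⟩ := exists_of_not_thin hG
  have hD : ∀ D : Set K, (∀ d ∈ D, ∃ s ∈ S, ∃ t ∈ S, s < t ∧ d = t - s) →
      D ⊆ (G : Set K) ∧ ∀ d ∈ D, 0 < d := by
    refine fun D hD => ⟨fun d hd => ?_, fun d hd => ?_⟩ <;>
      obtain ⟨s, hs, t, ht, hst, rfl⟩ := hD d hd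
    · exact sub_mem (hSG ht) (hSG hs)
    · exact sub_pos.2 hst
  obtain ⟨s₀, hs₀, u, hu, hconst⟩ := exists_constant_class hκ hS
    (fun D hd => h1 D (hD D hd).1 (hD D hd).2) (fun D hd => h2 D (hD D hd).1 (hD D hd).2)
  choose! f hfS hf using fun (q : ℚ) (hq : ∃ s ∈ S, s₀ + q * u ≤ s) => hq
  obtain ⟨s, hs, hlt⟩ := hS (insert s₀ (f '' {q | ∃ s ∈ S, s₀ + q * u ≤ s}))
    (Set.insert_subset hs₀ (by rintro _ ⟨q, hq, rfl⟩; exact hfS q hq))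
    ((le_aleph0_iff_set_countable.2 (((Set.to_countable _).image _).insert _)).trans hκ)
  have hs₀s := hlt s₀ (Set.mem_insert _ _)
  obtain ⟨t, ht, hst, hmk⟩ := hconst s hs hs₀s.le
  have htu := hmk t ht le_rfl
  obtain ⟨n, hn⟩ := mk_le_mk.1 htu.le
  obtain ⟨m, hm⟩ : ∃ m : ℕ, s - s₀ ≤ m * u := by
    obtain ⟨r, hr, hr1, hmk'⟩ := hconst s₀ hs₀ le_rfl
    have hmem : max r s ∈ S := by rcases max_choice r s with e | e <;> rwa [e]
    have := hmk' _ hmem (le_max_left _ _)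
    have h3 : ArchimedeanClass.mk u ≤ ArchimedeanClass.mk (s - s₀) := by
      rw [← this]
      exact mk_le_mk_of_pos_of_le (by linarith) (by linarith [le_max_right r s])
    obtain ⟨m, hm⟩ := mk_le_mk.1 h3
    rw [abs_of_pos hu] at hm
    exact ⟨m, ((le_abs_self _).trans hm).trans_eq (nsmul_eq_mul _ _)⟩
  rw [abs_of_pos hu, abs_of_pos (sub_pos.2 hst)] at hn
  replace hn : u ≤ n * (t - s) := hn.trans_eq (nsmul_eq_mul _ _)
  have hn0 : (0 : K) < n := by
    by_contra! h
    have := mul_nonpos_of_nonpos_of_nonneg h (sub_pos.2 hst).le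
    linarith
  -- With u ≤ n(t − s) and j least, s < s₀ + (j/n)u ≤ t, contradicting the choice of s.
  have hex : ∃ j : ℕ, n * (s - s₀) < j * u := ⟨n * (m + 1), by
    push_cast
    nlinarith⟩
  classical
  have hj := Nat.find_spec hex
  have hjmin := fun k => Nat.find_min hex (m := k)
  set j := Nat.find hex
  obtain ⟨i, hi⟩ : ∃ i, j = i + 1 := Nat.exists_eq_succ_of_ne_zero fun h0 => by
    rw [h0] at hj
    have := mul_pos hn0 (sub_pos.2 hs₀s)
    simp at hj
    linarith
  have hi' := hjmin i (by omega)
  rw [not_lt] at hi'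
  rw [hi] at hj
  push_cast at hj
  have hq : ∃ s ∈ S, s₀ + (((i + 1 : ℕ) / n : ℚ) : K) * u ≤ s := by
    refine ⟨t, ht, ?_⟩
    push_cast
    rw [← le_sub_iff_add_le', div_mul_eq_mul_div, div_le_iff₀ hn0]
    nlinarith
  have h3 := hlt _ (Set.mem_insert_of_mem _ ⟨_, hq, rfl⟩)
  have h4 := (hf _ hq).trans_lt h3
  push_cast at h4
  rw [← lt_sub_iff_add_lt', div_mul_eq_mul_div, div_lt_iff₀ hn0] at h4
  linarith

end ThinClasses

/-! ### Archimedean classes of a one-element extension -/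

section Classes

open ArchimedeanClass Polynomial

variable {K : Type u} [Field K] [LinearOrder K] [IsStrictOrderedRing K] {κ : Cardinal.{u}}

/-- Nonzero terms of distinct classes cannot cancel: the dominant one decides. -/
theorem exists_mk_sum_eq {ι : Type*} (s : Finset ι) (z : ι → K)
    (hinj : ∀ i ∈ s, ∀ j ∈ s, z i ≠ 0 → z j ≠ 0 →
      ArchimedeanClass.mk (z i) = ArchimedeanClass.mk (z j) → i = j)
    (hne : ∃ i ∈ s, z i ≠ 0) :
    ∃ i ∈ s, z i ≠ 0 ∧ ArchimedeanClass.mk (∑ i ∈ s, z i) = ArchimedeanClass.mk (z i) := by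
  classical
  induction s using Finset.induction_on with
  | empty => simp at hne
  | insert a s ha ih =>
    rw [Finset.sum_insert ha]
    by_cases hs : ∃ i ∈ s, z i ≠ 0
    · obtain ⟨i, hi, hzi, hmk⟩ := ih (fun i hi j hj =>
        hinj i (Finset.mem_insert_of_mem hi) j (Finset.mem_insert_of_mem hj)) hs
      have hi' : i ∈ insert a s := Finset.mem_insert_of_mem hi
      by_cases hza : z a = 0
      · exact ⟨i, hi', hzi, by rw [hza, zero_add, hmk]⟩
      · have hne' : ArchimedeanClass.mk (z a) ≠ ArchimedeanClass.mk (∑ i ∈ s, z i) := by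
          rw [hmk]
          intro h
          exact ha (hinj a (Finset.mem_insert_self a s) i hi' hza hzi h ▸ hi)
        rcases lt_or_gt_of_ne hne' with h | h
        · exact ⟨a, Finset.mem_insert_self a s, hza, mk_add_eq_mk_left h⟩
        · exact ⟨i, hi', hzi, by rw [mk_add_eq_mk_right h, hmk]⟩
    · push Not at hs
      rw [Finset.sum_eq_zero hs, add_zero]
      refine ⟨a, Finset.mem_insert_self a s, ?_, rfl⟩
      obtain ⟨i, hi, hzi⟩ := hne
      rcases Finset.mem_insert.1 hi with rfl | hi
      · exact hzi
      · exact absurd (hs i hi) hzi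

theorem exists_mk_pow_sub_eq {i j : ℕ} (hij : i < j) {x c d : K} (hx : x ≠ 0) (hd : d ≠ 0)
    (h : ArchimedeanClass.mk (c * x ^ i) = ArchimedeanClass.mk (d * x ^ j)) :
    ArchimedeanClass.mk (x ^ (j - i)) = ArchimedeanClass.mk (c / d) := by
  have e : x ^ (j - i) = (d * x ^ j) * (d * x ^ i)⁻¹ := by
    rw [pow_sub₀ _ hx hij.le]
    field_simp
  have e' : c / d = (c * x ^ i) * (d * x ^ i)⁻¹ := by
    field_simp
  rw [e, e', mk_mul, mk_mul (c * x ^ i), h]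

/-- Modulo torsion, the archimedean classes of the real closure of `F(y)` are obtained from those
of `F` by adding countably many. -/
theorem exists_countable_classes {F : Subfield K} (hF : IsRelClosed F) (y : K) :
    ∃ E : Set K, E.Countable ∧ ∀ x ∈ realClosureIn (insert y (F : Set K)), x ≠ 0 →
      ∃ n : ℕ, n ≠ 0 ∧ ∃ e ∈ E, ∃ f ∈ F, e ≠ 0 ∧ f ≠ 0 ∧
        ArchimedeanClass.mk (x ^ n) = ArchimedeanClass.mk (e * f) := by
  by_cases htors : ∀ x ∈ realClosureIn (insert y (F : Set K)), x ≠ 0 →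
      ∃ n : ℕ, n ≠ 0 ∧ ∃ f ∈ F, f ≠ 0 ∧ ArchimedeanClass.mk (x ^ n) = ArchimedeanClass.mk f
  · refine ⟨{1}, Set.countable_singleton 1, fun x hx hx0 => ?_⟩
    obtain ⟨n, hn, f, hf, hf0, h⟩ := htors x hx hx0
    exact ⟨n, hn, 1, rfl, f, hf, one_ne_zero, hf0, by rwa [one_mul]⟩
  push Not at htors
  obtain ⟨b, hb, hb0, htf⟩ := htors
  have hbF : b ∉ F := fun h => htf 1 one_ne_zero b h hb0 (by rw [pow_one])
  -- No positive power of `b` has a class from `F`. By exchange `b` may replace `y`, and the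
  -- monomials of a polynomial in `b` have distinct classes.
  have hyb := realClosureIn_exchange hb fun h => hbF (hF h)
  have haeval : ∀ p : F[X], aeval b p ≠ 0 → ∃ k : ℕ, ∃ f ∈ F, f ≠ 0 ∧
      ArchimedeanClass.mk (aeval b p) = ArchimedeanClass.mk (b ^ k * f) := by
    intro p hp
    have hsum : aeval b p = ∑ i ∈ Finset.range (p.natDegree + 1), (p.coeff i : K) * b ^ i := by
      rw [aeval_eq_sum_range]; rfl
    obtain ⟨k, -, hk0, hk⟩ := exists_mk_sum_eq (Finset.range (p.natDegree + 1))
      (fun i => (p.coeff i : K) * b ^ i) (by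
        intro i _ j _ hi hj hij
        have key : ∀ i j : ℕ, (p.coeff i : K) * b ^ i ≠ 0 → (p.coeff j : K) * b ^ j ≠ 0 →
            ArchimedeanClass.mk ((p.coeff i : K) * b ^ i) =
              ArchimedeanClass.mk ((p.coeff j : K) * b ^ j) → ¬ i < j := fun i j hi hj hij h =>
          htf (j - i) (by omega) _ (div_mem (p.coeff i).2 (p.coeff j).2)
            (div_ne_zero (left_ne_zero_of_mul hi) (left_ne_zero_of_mul hj))
            (exists_mk_pow_sub_eq h hb0 (left_ne_zero_of_mul hj) hij)
        exact le_antisymm (not_lt.1 (key j i hj hi hij.symm)) (not_lt.1 (key i j hi hj hij)))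
      (by
        by_contra! h
        exact hp (by rw [hsum, Finset.sum_eq_zero h]))
    exact ⟨k, p.coeff k, (p.coeff k).2, left_ne_zero_of_mul hk0, by rw [hsum, hk, mul_comm]⟩
  refine ⟨Set.range fun k : ℤ => b ^ k, Set.countable_range _, fun x hx hx0 => ?_⟩
  have hxb : x ∈ realClosureIn (insert b (F : Set K)) :=
    realClosureIn_subset (Set.insert_subset hyb
      ((Set.subset_insert _ _).trans (subset_realClosureIn _))) hx
  obtain ⟨Q, hQ, hQx⟩ := exists_bivariate_of_mem_realClosureIn hxb
  set q := Q.map (aeval b : F[X] →ₐ[F] K).toRingHom with hq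
  rw [eval_eq_sum_range] at hQx
  -- As the terms of Q(b, x) sum to zero, two of them share a class, which gives the class of a
  -- power of `x`.
  have hpair : ∃ i j : ℕ, i < j ∧ q.coeff i ≠ 0 ∧ q.coeff j ≠ 0 ∧
      ArchimedeanClass.mk (q.coeff i * x ^ i) = ArchimedeanClass.mk (q.coeff j * x ^ j) := by
    by_contra! hcon
    obtain ⟨k, -, hk0, hk⟩ := exists_mk_sum_eq (Finset.range (q.natDegree + 1))
      (fun i => q.coeff i * x ^ i) (by
        intro i _ j _ hi hj hij
        refine le_antisymm (not_lt.1 fun h => ?_) (not_lt.1 fun h => ?_)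
        · exact hcon j i h (left_ne_zero_of_mul hj) (left_ne_zero_of_mul hi) hij.symm
        · exact hcon i j h (left_ne_zero_of_mul hi) (left_ne_zero_of_mul hj) hij)
      ⟨q.natDegree, by simp, mul_ne_zero (leadingCoeff_ne_zero.2 hQ) (pow_ne_zero _ hx0)⟩
    rw [hQx, mk_zero] at hk
    exact hk0 (mk_eq_top_iff.1 hk.symm)
  obtain ⟨i, j, hij, hi, hj, hmk⟩ := hpair
  have hcoeff : ∀ i, q.coeff i ≠ 0 → ∃ k : ℕ, ∃ f ∈ F, f ≠ 0 ∧
      ArchimedeanClass.mk (q.coeff i) = ArchimedeanClass.mk (b ^ k * f) := fun i hi => by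
    rw [hq, coeff_map] at hi ⊢
    exact haeval _ hi
  obtain ⟨k, f, hf, hf0, hkf⟩ := hcoeff i hi
  obtain ⟨l, g, hg, hg0, hlg⟩ := hcoeff j hj
  refine ⟨j - i, by omega, b ^ ((k : ℤ) - l), ⟨_, rfl⟩, f / g, div_mem hf hg,
    zpow_ne_zero _ hb0, div_ne_zero hf0 hg0, ?_⟩
  rw [exists_mk_pow_sub_eq hij hx0 hj hmk, mk_div, hkf, hlg, ← mk_div]
  congr 1
  rw [zpow_sub₀ hb0, zpow_natCast, zpow_natCast]
  field_simp

theorem mk_le_mk_of_pow {n : ℕ} (hn : n ≠ 0) {x y : K}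
    (h : ArchimedeanClass.mk (x ^ n) ≤ ArchimedeanClass.mk (y ^ n)) :
    ArchimedeanClass.mk x ≤ ArchimedeanClass.mk y := by
  obtain ⟨N, hN⟩ := mk_le_mk.1 h
  replace hN : |y ^ n| ≤ N * |x ^ n| := hN.trans_eq (nsmul_eq_mul _ _)
  refine mk_le_mk.2 ⟨N + 1, ?_⟩
  refine LE.le.trans_eq ?_ (nsmul_eq_mul (N + 1) |x|).symm
  rw [abs_pow, abs_pow] at hN
  refine le_of_pow_le_pow_left₀ hn (by positivity) (hN.trans ?_)
  rw [mul_pow]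
  refine mul_le_mul_of_nonneg_right ?_ (by positivity)
  push_cast
  have h1 : (1 : K) ≤ N + 1 := by linarith [Nat.cast_nonneg (α := K) N]
  calc (N : K) ≤ N + 1 := by linarith
    _ ≤ (N + 1) ^ n := le_self_pow₀ h1 hn

/-- Colour a positive x by the pair (n, e) with xⁿ of the class of e·f. Within a colour, classes
compare as the f in `F` do; passing to f⁻¹ handles the opposite direction. -/
theorem Thin.realClosureIn_insert (hκ : ℵ₀ ≤ κ) {F : Subfield K} (hF : IsRelClosed F)
    (hthin : Thin κ (F : Set K)) (y : K) : Thin κ (realClosureIn (insert y (F : Set K))) := by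
  obtain ⟨E, hE, hEF⟩ := exists_countable_classes hF y
  have hEF' : ∀ x ∈ realClosureIn (insert y (F : Set K)), 0 < x →
      ∃ n : ℕ, n ≠ 0 ∧ ∃ e ∈ E, ∃ f ∈ F, e ≠ 0 ∧ 0 < f ∧
        ArchimedeanClass.mk (x ^ n) = ArchimedeanClass.mk (e * f) := by
    intro x hx hx0
    obtain ⟨n, hn, e, he, f, hf, he0, hf0, h⟩ := hEF x hx hx0.ne'
    refine ⟨n, hn, e, he, |f|, ?_, he0, abs_pos.2 hf0, by rw [h, mk_mul, mk_mul, mk_abs]⟩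
    rcases abs_choice f with h | h <;> rw [h]
    · exact hf
    · exact neg_mem hf
  choose! n hn e he f hf he0 hf0 hmk using hEF'
  rw [← coe_realClosureField]
  have hcount : ∀ D : Set K, D ⊆ (realClosureField (insert y (F : Set K)) : Set K) →
      (∀ d ∈ D, 0 < d) → ((fun x => ((ULift.up.{u} (n x) : ULift.{u} ℕ), e x)) '' D).Countable := by
    intro D hD hpos
    refine (Set.Countable.prod (Set.to_countable Set.univ) hE).mono ?_
    rintro _ ⟨x, hx, rfl⟩
    rw [coe_realClosureField] at hD
    exact ⟨Set.mem_univ _, he x (hD hx) (hpos x hx)⟩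
  have hcomp : ∀ x x' : K, e x = e x' → f x ≤ f x' → 0 < f x → ArchimedeanClass.mk (e x' * f x') ≤
      ArchimedeanClass.mk (e x * f x) := by
    intro x x' h1 h2 h3
    rw [h1, mk_mul, mk_mul]
    exact add_le_add_right (mk_le_mk_of_pos_of_le h3.le h2) _
  refine thin_of_classes hκ (fun D hD hpos => ?_) (fun D hD hpos => ?_)
  · have hD' := hD
    rw [coe_realClosureField] at hD'
    obtain ⟨D', hD'D, hD'κ, h⟩ := hthin.exists_of_fibers hκ D f
      (fun x hx => hf x (hD' hx) (hpos x hx)) _ (hcount D hD hpos)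
    refine ⟨D', hD'D, hD'κ, fun x hx => ?_⟩
    obtain ⟨x', hx', heq, hle⟩ := h x hx
    simp only [Prod.mk.injEq, ULift.up.injEq] at heq
    have hxm := hmk x (hD' hx) (hpos x hx)
    have hxm' := hmk x' (hD' (hD'D hx')) (hpos x' (hD'D hx'))
    refine ⟨x', hx', mk_le_mk_of_pow (hn x (hD' hx) (hpos x hx)) ?_⟩
    rw [hxm, heq.1, hxm']
    exact hcomp x x' heq.2 hle (hf0 x (hD' hx) (hpos x hx))
  · have hD' := hD
    rw [coe_realClosureField] at hD'
    obtain ⟨D', hD'D, hD'κ, h⟩ := hthin.exists_of_fibers hκ D (fun x => (f x)⁻¹)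
      (fun x hx => inv_mem (hf x (hD' hx) (hpos x hx))) _ (hcount D hD hpos)
    refine ⟨D', hD'D, hD'κ, fun x hx => ?_⟩
    obtain ⟨x', hx', heq, hle⟩ := h x hx
    simp only [Prod.mk.injEq, ULift.up.injEq] at heq
    have hxm := hmk x (hD' hx) (hpos x hx)
    have hxm' := hmk x' (hD' (hD'D hx')) (hpos x' (hD'D hx'))
    have hfx := hf0 x (hD' hx) (hpos x hx)
    have hfx' := hf0 x' (hD' (hD'D hx')) (hpos x' (hD'D hx'))
    refine ⟨x', hx', mk_le_mk_of_pow (hn x (hD' hx) (hpos x hx)) ?_⟩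
    rw [hxm, heq.1, hxm']
    exact hcomp x' x heq.2.symm ((inv_le_inv₀ hfx hfx').1 hle) hfx'

theorem Thin.realClosureIn_union_finite (hκ : ℵ₀ ≤ κ) {F : Subfield K} (hF : IsRelClosed F)
    (hthin : Thin κ (F : Set K)) {R : Set K} (hR : R.Finite) :
    Thin κ (realClosureIn ((F : Set K) ∪ R)) := by
  induction R, hR using Set.Finite.induction_on with
  | empty => rwa [Set.union_empty, hF.eq]
  | @insert y R _ _ ih =>
    rw [← coe_realClosureField] at ih
    have := ih.realClosureIn_insert hκ (isRelClosed_realClosureField _) y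
    rwa [coe_realClosureField, realClosureIn_eq_closure, realClosureIn_eq_closure,
      Matroid.closure_insert_closure_eq_closure_insert, ← realClosureIn_eq_closure,
      ← Set.union_insert] at this

end Classes

/-! ### Independent extensions of thin fields -/

section Extension

variable {K : Type u} [Field K] [LinearOrder K] [IsStrictOrderedRing K]
  {κ : Cardinal.{u}} {F : Subfield K} {A : Set K}

-- Take s₀ in S beyond a small cofinal set of the elements of `G` that S dominates; no element of
-- `G` then separates later members of S.
omit [IsStrictOrderedRing K] in
theorem exists_forall_sameCut {G : Subfield K} (hG : Thin κ (G : Set K)) {S : Set K}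
    (hS : ∀ T ⊆ S, #T ≤ κ → ∃ s ∈ S, ∀ t ∈ T, t < s) :
    ∃ s₀ ∈ S, s₀ ∉ G ∧ ∀ s ∈ S, s₀ ≤ s → SameCut G s₀ s := by
  obtain ⟨T, hT, hTκ, hTG⟩ := hG {g | g ∈ G ∧ ∃ s ∈ S, g ≤ s} fun g hg => hg.1
  replace hT : ∀ t ∈ T, ∃ s ∈ S, t ≤ s := fun t ht => (hT ht).2
  choose! f hfS hf using hT
  obtain ⟨s₀, hs₀, hlt⟩ := hS (f '' T) (by rintro _ ⟨t, ht, rfl⟩; exact hfS t ht)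
    (mk_image_le.trans hTκ)
  have key : ∀ s ∈ S, s₀ ≤ s → ∀ g ∈ G, (∃ s' ∈ S, g ≤ s') → g < s := by
    rintro s hs hle g hg hex
    obtain ⟨t, ht, hgt⟩ := hTG g ⟨hg, hex⟩
    exact (hgt.trans (hf t ht)).trans_lt ((hlt _ ⟨t, ht, rfl⟩).trans_le hle)
  have hnot : ∀ s ∈ S, s₀ ≤ s → s ∉ G := fun s hs hle hsG =>
    lt_irrefl s (key s hs hle s hsG ⟨s, hs, le_rfl⟩)
  refine ⟨s₀, hs₀, hnot s₀ hs₀ le_rfl, fun s hs hle =>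
    sameCut_of_forall_lt_iff (hnot s₀ hs₀ le_rfl) (hnot s hs hle) fun g hg => ?_⟩
  exact ⟨fun h => key s hs hle g hg ⟨s₀, hs₀, h.le⟩,
    fun h => key s₀ hs₀ le_rfl g hg ⟨s, hs, h.le⟩⟩

/-- Common points chosen for different k are distinct, since each is absorbed into the next `R`;
they cannot all lie in a finite set. -/
theorem exists_disjoint_of_finite {α : Type*} (R : ℕ → Set α) (P : ℕ → Set α)
    (hR : ∀ k, R (k + 1) = R k ∪ P k) {P' : Set α} (hP' : P'.Finite) :
    ∃ k, Disjoint (P k \ R k) (P' \ R k) := by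
  by_contra! hcon
  simp only [Set.not_disjoint_iff] at hcon
  choose x hx hx' using hcon
  have hmono : Monotone R := monotone_nat_of_le_succ fun k => by
    rw [hR]; exact Set.subset_union_left
  have hinj : Function.Injective x := by
    have key : ∀ k l, k < l → x k ≠ x l := fun k l hkl he => by
      refine (hx l).2 (hmono hkl ?_)
      rw [Nat.succ_eq_add_one, hR, ← he]
      exact .inr (hx k).1
    intro k l h
    rcases lt_trichotomy k l with h' | h' | h'
    · exact absurd h (key k l h')
    · exact h'
    · exact absurd h.symm (key l k h')
  exact Set.infinite_range_of_injective hinj (hP'.subset (by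
    rintro _ ⟨k, rfl⟩; exact (hx' k).1))

theorem Thin.realClosureIn_union [IsRealClosed K] (hκ : ℵ₀ ≤ κ) (hF : IsRelClosed F)
    (hthin : Thin κ (F : Set K)) (hA : CutIndep F A) :
    Thin κ (realClosureIn ((F : Set K) ∪ A)) := by
  by_contra hbad
  obtain ⟨S, hSA, hS⟩ := exists_of_not_thin hbad
  have hsupp : ∀ s ∈ S, ∃ P ⊆ A, P.Finite ∧ s ∈ realClosureIn ((F : Set K) ∪ P) := fun s hs =>
    exists_finite_mem_realClosureIn_union (hSA hs)
  choose! P hPA hPfin hP using hsupp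
  have hstep : ∀ R : {R : Set K // R.Finite ∧ R ⊆ A}, ∃ s₀ ∈ S,
      s₀ ∉ realClosureField ((F : Set K) ∪ R.1) ∧ ∀ s ∈ S, s₀ ≤ s →
        SameCut (realClosureField ((F : Set K) ∪ R.1)) s₀ s := fun R =>
    exists_forall_sameCut (by
      rw [coe_realClosureField]
      exact hthin.realClosureIn_union_finite hκ hF R.2.1) hS
  choose σ hσS hσG hσ using hstep
  -- Each stage adds the support of σ(R k), the point past which S stays in one cut over F(R k). An
  -- s above all these points shares such a cut with every σ(R k), and for some k their supports are
  -- disjoint outside R k.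
  let R : ℕ → {R : Set K // R.Finite ∧ R ⊆ A} := fun k => Nat.rec ⟨∅, Set.finite_empty,
    Set.empty_subset _⟩ (fun _ R => ⟨R.1 ∪ P (σ R), R.2.1.union (hPfin _ (hσS R)),
      Set.union_subset R.2.2 (hPA _ (hσS R))⟩) k
  obtain ⟨s, hs, hlt⟩ := hS (Set.range fun k => σ (R k))
    (by rintro _ ⟨k, rfl⟩; exact hσS _)
    ((le_aleph0_iff_set_countable.2 (Set.countable_range _)).trans hκ)
  obtain ⟨k, hk⟩ := exists_disjoint_of_finite (fun k => (R k).1) (fun k => P (σ (R k)))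
    (fun k => rfl) (hPfin s hs)
  have hmem : ∀ t ∈ S, t ∈ realClosureIn
      ((realClosureField ((F : Set K) ∪ (R k).1) : Set K) ∪ (P t \ (R k).1)) := fun t ht => by
    rw [coe_realClosureField, realClosureIn_realClosureIn_union, Set.union_assoc,
      Set.union_sdiff_self]
    exact realClosureIn_mono (Set.union_subset_union_right _ Set.subset_union_right) (hP t ht)
  have hcut := hσ (R k) s hs (hlt _ ⟨k, rfl⟩).le
  exact hcut.notMem (hσG (R k)) ((hA.adjoin (R k).2.2).mem_of_sameCut
    (isRelClosed_realClosureField _) (Set.sdiff_subset_sdiff_left (hPA _ (hσS (R k))))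
    (Set.sdiff_subset_sdiff_left (hPA s hs)) hk ((hPfin _ (hσS (R k))).sdiff)
    (hmem _ (hσS (R k))) (hmem s hs) hcut)

omit [LinearOrder K] [IsStrictOrderedRing K] in
theorem mk_realClosureIn_le (S : Set K) : #(realClosureIn S) ≤ max #S ℵ₀ := by
  have h1 := Algebraic.cardinalMk_le_max (Subfield.closure S) K
  refine h1.trans (max_le ?_ (le_max_right _ _))
  exact Subfield.cardinalMk_closure_le_max S

-- Independence makes members of `A` realize distinct cuts, and a κ-sized cofinal subset of the
-- lower half determines the cut.
omit [IsStrictOrderedRing K] in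
theorem CutIndep.mk_le (hκ : ℵ₀ ≤ κ) (hthin : Thin κ (F : Set K)) (hF : #F ≤ 2 ^ κ)
    (hA : CutIndep F A) : #A ≤ 2 ^ κ := by
  have hAF : ∀ x ∈ A, x ∉ F := fun x hx hxF =>
    hA x hx x (subset_realClosureIn _ (.inl hxF)) (.refl F x)
  choose T hT hTκ hTF using fun x : K => hthin {g | g ∈ F ∧ g < x} fun g hg => hg.1
  have hinj : Function.Injective (fun x : A =>
      (⟨T x, (hT x).trans fun g hg => hg.1, hTκ x⟩ : {t : Set K // t ⊆ (F : Set K) ∧ #t ≤ κ})) := by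
    have key : ∀ x y : K, T x = T y → ∀ g ∈ F, g < x → g < y := by
      intro x y hxy g hg hgx
      obtain ⟨t, ht, hgt⟩ := hTF x g ⟨hg, hgx⟩
      exact hgt.trans_lt (hT y (hxy ▸ ht)).2
    intro x y hxy
    replace hxy : T x = T y := congrArg Subtype.val hxy
    by_contra hne
    refine hA x x.2 y (subset_realClosureIn _ (.inr ⟨y.2, fun h => hne (Subtype.ext h.symm)⟩))
      (sameCut_of_forall_lt_iff (hAF x x.2) (hAF y y.2) fun g hg =>
        ⟨key x y hxy g hg, key y x hxy.symm g hg⟩)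
  calc #A ≤ _ := mk_le_of_injective hinj
    _ ≤ max #(F : Set K) ℵ₀ ^ κ := mk_bounded_subset_le _ _
    _ ≤ (2 ^ κ) ^ κ := power_le_power_right (max_le hF (hκ.trans (cantor κ).le))
    _ = 2 ^ κ := by rw [← power_mul, mul_eq_self hκ]

omit [IsStrictOrderedRing K] in
theorem CutIndep.mk_realClosureIn_le (hκ : ℵ₀ ≤ κ) (hthin : Thin κ (F : Set K)) (hF : #F ≤ 2 ^ κ)
    (hA : CutIndep F A) : #(realClosureIn ((F : Set K) ∪ A)) ≤ 2 ^ κ := by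
  have hinf : ℵ₀ ≤ (2 : Cardinal.{u}) ^ κ := hκ.trans (cantor κ).le
  refine (_root_.mk_realClosureIn_le _).trans (max_le ((mk_union_le _ _).trans ?_) hinf)
  exact add_le_of_le hinf hF (hA.mk_le hκ hthin hF)

end Extension

/-! ### Cuts as pairs of sets, and one-cut extensions -/

section Cuts

variable {K : Type u} [Field K] [LinearOrder K]

theorem FieldCut.mem_lower_or_mem_upper {F : Type u} [LinearOrder F] (C : FieldCut F) (y : F) :
    y ∈ C.lower ∨ y ∈ C.upper := by
  have : y ∈ C.lower ∪ C.upper := C.union_eq ▸ Set.mem_univ y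
  exact this

theorem FieldCut.RealizedBy.eq {F : Subfield K} {C D : FieldCut F} {x : K}
    (hC : C.RealizedBy x) (hD : D.RealizedBy x) : C = D := by
  have hlow : ∀ E : FieldCut F, E.RealizedBy x → E.lower = {y : F | (y : K) < x} := fun E hE =>
    Set.ext fun y => ⟨fun hy => hE.1 y hy, fun hy => (E.mem_lower_or_mem_upper y).resolve_right
      fun h => lt_asymm hy (hE.2 y h)⟩
  have hupp : ∀ E : FieldCut F, E.RealizedBy x → E.upper = {y : F | x < (y : K)} := fun E hE =>
    Set.ext fun y => ⟨fun hy => hE.2 y hy, fun hy => (E.mem_lower_or_mem_upper y).resolve_left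
      fun h => lt_asymm hy (hE.1 y h)⟩
  exact FieldCut.ext ((hlow C hC).trans (hlow D hD).symm) ((hupp C hC).trans (hupp D hD).symm)

theorem FieldCut.exists_realizedBy {F : Subfield K} {x : K} (hx : x ∉ F) :
    ∃ C : FieldCut F, C.RealizedBy x := by
  refine ⟨⟨{y : F | (y : K) < x}, {y : F | x < (y : K)}, ?_, ?_, ?_⟩, fun _ h => h, fun _ h => h⟩
  · exact Set.disjoint_left.2 fun y h1 h2 => lt_asymm h1 h2
  · refine Set.eq_univ_of_forall fun y => lt_or_gt_of_ne ?_
    rintro rfl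
    exact hx y.2
  · exact fun y hy z hz => lt_trans (b := x) hy hz

theorem FieldCut.RealizedBy.notMem {F : Subfield K} {C : FieldCut F} {x : K}
    (hC : C.RealizedBy x) : x ∉ F := fun hx =>
  (C.mem_lower_or_mem_upper ⟨x, hx⟩).elim (fun h => lt_irrefl _ (hC.1 _ h))
    fun h => lt_irrefl _ (hC.2 _ h)

theorem FieldCut.RealizedBy.congr {F : Subfield K} {C : FieldCut F} {x y : K}
    (hC : C.RealizedBy x) (hxy : SameCut F x y) : C.RealizedBy y :=
  ⟨fun z hz => (hxy z z.2).1.1 (hC.1 z hz), fun z hz => (hxy z z.2).2.1 (hC.2 z hz)⟩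

theorem CutsIndependent.cutIndep [IsStrictOrderedRing K] [IsRealClosed K] {F : Subfield K}
    {𝒞 : Set (FieldCut F)} (h𝒞 : CutsIndependent 𝒞) {a : FieldCut F → K}
    (ha : ∀ C ∈ 𝒞, C.RealizedBy (a C)) : CutIndep F (a '' 𝒞) := by
  rintro _ ⟨C, hC, rfl⟩ y hy hxy
  refine h𝒞 K (fun _ _ h => h) (𝒞 \ {C}) Set.sdiff_subset a (fun D hD => ha D hD.1) C
    ⟨hC, fun h => h.2 rfl⟩ y (realClosureIn_mono ?_ hy) ((ha C hC).congr hxy)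
  refine Set.union_subset_union (fun z hz => ⟨⟨z, hz⟩, rfl⟩) ?_
  rintro _ ⟨⟨D, hD, rfl⟩, hne⟩
  exact ⟨D, ⟨hD, fun h => hne (by rw [Set.mem_singleton_iff] at h ⊢; rw [h])⟩, rfl⟩

theorem isAlgebraic_of_mem_realClosureIn_range {F L : Type*} [Field F] [Field L] [Algebra F L]
    {x : L} (hx : x ∈ realClosureIn (Set.range (algebraMap F L))) : IsAlgebraic F x := by
  have hx' : IsAlgebraic (algebraMap F L).range x := by
    refine isAlgebraic_of_le (fun y hy => ?_) hx
    have : Set.range (algebraMap F L) = ((algebraMap F L).fieldRange : Set L) := rfl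
    rwa [this, Subfield.closure_eq] at hy
  obtain ⟨p, hp, hpx⟩ := hx'
  obtain ⟨q, rfl⟩ := Polynomial.map_surjective (algebraMap F L).rangeRestrict
    (RingHom.rangeRestrict_surjective _) p
  refine ⟨q, by rintro rfl; simp at hp, ?_⟩
  rw [← Polynomial.eval_map_algebraMap, Polynomial.map_map] at hpx
  rwa [← Polynomial.eval_map_algebraMap]

/-- Only the empty subfamily has to be tested, and `F` is algebraically closed in any ordered
extension, so nothing new appears. -/
theorem cutsIndependent_of_subsingleton {F : Type u} [Field F] [LinearOrder F]
    [IsStrictOrderedRing F] [IsRealClosed F] {𝒞 : Set (FieldCut F)} (h𝒞 : 𝒞.Subsingleton) :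
    CutsIndependent 𝒞 := by
  intro L _ _ _ _ _ hmono 𝒞₀ h𝒞₀ a _ C hC b hb hCb
  have hempty : 𝒞₀ = ∅ := Set.eq_empty_of_forall_notMem fun D hD =>
    hC.2 (h𝒞 (h𝒞₀ hD) hC.1 ▸ hD)
  rw [hempty, Set.image_empty, Set.union_empty] at hb
  obtain ⟨y, rfl⟩ := IsRealClosed.mem_range_of_isAlgebraic hmono
    (isAlgebraic_of_mem_realClosureIn_range hb)
  rcases C.mem_lower_or_mem_upper y with h | h
  · exact lt_irrefl _ (hCb.1 y h)
  · exact lt_irrefl _ (hCb.2 y h)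

theorem isIndependentCutExtension_insert [IsStrictOrderedRing K] [IsRealClosed K] (S : Set K)
    (x : K) : IsIndependentCutExtension (realClosureField S) (realClosureField (insert x S)) := by
  have : IsRealClosed (realClosureField S) := (isRelClosed_realClosureField S).isRealClosed
  refine ⟨{C | C.RealizedBy x}, fun _ => x,
    cutsIndependent_of_subsingleton fun C hC D hD => hC.eq hD, fun C hC => hC, ?_⟩
  rw [coe_realClosureField, coe_realClosureField, realClosureIn_realClosureIn_union]
  -- If `x` is already present it realizes no cut, and the extension by the empty family is trivial.
  by_cases hx : x ∈ realClosureField S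
  · have hempty : {C : FieldCut (realClosureField S) | C.RealizedBy x} = ∅ :=
      Set.eq_empty_of_forall_notMem fun C hC => hC.notMem hx
    rw [hempty, Set.image_empty, Set.union_empty]
    exact (realClosureIn_subset (Set.insert_subset (mem_realClosureField.1 hx)
      (subset_realClosureIn S))).antisymm (realClosureIn_mono (Set.subset_insert x S))
  · have hne : {C : FieldCut (realClosureField S) | C.RealizedBy x}.Nonempty :=
      FieldCut.exists_realizedBy hx
    rw [hne.image_const, Set.union_singleton]

end Cuts

/-! ### Height chains and the cardinality bounds -/

section Chains

variable (K : Type u) [Field K] [LinearOrder K] [IsStrictOrderedRing K] [IsRealClosed K]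

/-- Enumerating `K` gives a chain whose length is the initial ordinal of the cardinality of `K`. -/
theorem ord_mem_heightChainLengths : (#K).ord ∈ heightChainLengths K := by
  obtain ⟨e⟩ : Nonempty (K ≃ (#K).ord.ToType) := Cardinal.eq.1 (mk_ord_toType _).symm
  let idx : K → Ordinal.{u} := fun x => ((e x).toOrd : Set.Iio (#K).ord)
  have hlt : ∀ x, idx x < (#K).ord := fun x => (e x).toOrd.2
  have hinj : Function.Injective idx := fun x y h =>
    e.injective (ToType.mk.symm.injective (Subtype.ext h))
  have hsurj : ∀ i < (#K).ord, ∃ x, idx x = i := fun i hi =>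
    ⟨e.symm (ToType.mk ⟨i, hi⟩), by simp [idx]⟩
  refine ⟨fun i => realClosureField {x | idx x < i}, ?_, ?_, ?_, ?_, ?_, ?_⟩
  · exact fun i _ => (isRelClosed_realClosureField _).isRealClosed
  · intro i j hij _ x hx
    exact mem_realClosureField.2 (realClosureIn_mono (fun y (hy : idx y < i) => hy.trans_le hij)
      (mem_realClosureField.1 hx))
  · intro i _ hi x hx
    obtain ⟨T, hT, hfin, hxT⟩ := exists_finite_mem_realClosureIn (mem_realClosureField.1 hx)
    have hbdd : ∃ j < i, ∀ t ∈ T, idx t < j := by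
      clear hxT
      induction T, hfin using Set.Finite.induction_on with
      | empty => exact ⟨0, _root_.pos_iff_ne_zero.2 fun h => hi.1 (h ▸ isMin_bot), by simp⟩
      | @insert t T _ _ ih =>
        obtain ⟨j, hj, hjT⟩ := ih ((Set.subset_insert t T).trans hT)
        refine ⟨max j (Order.succ (idx t)), max_lt hj (hi.succ_lt (hT (Set.mem_insert t T))), ?_⟩
        rintro s (rfl | hs)
        · exact lt_max_of_lt_right (Order.lt_succ _)
        · exact lt_max_of_lt_left (hjT s hs)
    obtain ⟨j, hj, hjT⟩ := hbdd
    exact ⟨j, hj, mem_realClosureField.2 (realClosureIn_mono hjT hxT)⟩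
  · rw [coe_realClosureField, ← le_aleph0_iff_set_countable]
    refine (mk_realClosureIn_le _).trans (max_le ?_ le_rfl)
    have : {x : K | idx x < 0} = ∅ := Set.eq_empty_of_forall_notMem fun x (hx : idx x < 0) =>
      not_lt_zero hx
    rw [this]
    simp
  · exact eq_top_iff.2 fun x _ => mem_realClosureField.2 (subset_realClosureIn _ (hlt x))
  · intro i hi
    obtain ⟨x, hx⟩ := hsurj i hi
    have : {y | idx y < i + 1} = insert x {y | idx y < i} := by
      ext y
      simp only [Set.mem_insert_iff, Set.mem_ofPred_eq]
      rw [← Order.succ_eq_add_one, Order.lt_succ_iff, le_iff_eq_or_lt, ← hinj.eq_iff, hx]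
    rw [this]
    exact isIndependentCutExtension_insert _ x

variable {K}

/-- The two claims go through the induction together: at a successor, thinness of the previous stage
bounds the number of new generators. -/
theorem IsHeightChain.thin_and_mk_le {α : Ordinal.{u}} {F : Ordinal.{u} → Subfield K}
    (hF : IsHeightChain α F) {κ : Cardinal.{u}} (hκ : ℵ₀ ≤ κ) (hα : α.card ≤ κ) (i : Ordinal.{u})
    (hi : i ≤ α) : Thin κ (F i : Set K) ∧ #(F i : Set K) ≤ 2 ^ κ := by
  have hκ2 : κ ≤ 2 ^ κ := (cantor κ).le
  induction i using Ordinal.limitRecOn with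
  | zero =>
    exact ⟨thin_of_countable hκ hF.countable_zero,
      (le_aleph0_iff_set_countable.2 hF.countable_zero).trans (hκ.trans hκ2)⟩
  | add_one i ih =>
    have hi' : i < α := (lt_add_one i).trans_le hi
    obtain ⟨hthin, hcard⟩ := ih hi'.le
    obtain ⟨𝒞, a, h𝒞, ha, heq⟩ := hF.step i hi'
    have : IsRealClosed (F i) := hF.realClosed i hi'.le
    have hindep := h𝒞.cutIndep ha
    rw [heq]
    exact ⟨hthin.realClosureIn_union hκ isRelClosed_of_isRealClosed hindep,
      hindep.mk_realClosureIn_le hκ hthin hcard⟩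
  | limit i hlim ih =>
    have hunion : (F i : Set K) = ⋃ j : i.ToType, (F j.toOrd : Set K) := by
      refine Set.Subset.antisymm (fun x hx => ?_) (Set.iUnion_subset fun j =>
        hF.mono _ _ j.toOrd.2.le hi)
      obtain ⟨j, hj, hxj⟩ := hF.continuous i hi hlim x hx
      exact Set.mem_iUnion.2 ⟨ToType.mk ⟨j, hj⟩, by simpa using hxj⟩
    have ih' : ∀ j : i.ToType, _ := fun j => ih j.toOrd j.toOrd.2 (j.toOrd.2.le.trans hi)
    have hιcard : #i.ToType ≤ κ := by
      rw [mk_toType]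
      exact (card_le_card hi).trans hα
    rw [hunion]
    refine ⟨Thin.iUnion hκ hιcard fun j => (ih' j).1, (mk_iUnion_le _).trans ?_⟩
    exact (mul_le_mul' (hιcard.trans hκ2) (ciSup_le' fun j => (ih' j).2)).trans
      (mul_eq_self (hκ.trans hκ2)).le

end Chains

theorem mainTheorem6 (K : Type u) [Field K] [LinearOrder K] [IsStrictOrderedRing K]
    [IsRealClosed K] :
    IsLeast (heightChainLengths K) (height K) ∧
      (height K).card ≤ #K ∧ #K ≤ 2 ^ max (height K).card ℵ₀ := by
  have hmem : height K ∈ heightChainLengths K := csInf_mem ⟨_, ord_mem_heightChainLengths K⟩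
  have hle : ∀ α ∈ heightChainLengths K, height K ≤ α := fun α hα => csInf_le' hα
  refine ⟨⟨hmem, hle⟩, ?_, ?_⟩
  · have := card_le_card (hle _ (ord_mem_heightChainLengths K))
    rwa [card_ord] at this
  · obtain ⟨F, hF⟩ := hmem
    have := (hF.thin_and_mk_le (le_max_right _ _) (le_max_left _ _) _ le_rfl).2
    rwa [hF.top, Subfield.coe_top, mk_univ] at this
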